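/- **Setting.** Let $G=(V,E)$ be a finite directed acyclic graph (parallel edges allowed), where an edge $e$ goes from its tail $t(e)$ to its head $h(e)$. Let $\mathbf a\in\mathbb Z^V$ be a nonzero integer netflow vector. The flow polytope $\mathcal F_G(\mathbf a)$ is the set of $F\in\mathbb R_{\ge 0}^E$ with $\sum_{t(e)=i}F(e)-\sum_{h(e)=i}F(e)=\mathbf a_i$ for all $i\in V$; it may be empty. **Augmentations.** An *augmentation* $(\hat G,\hat{\mathbf a})$ of $(G,\mathbf a)$ is a finite graph $\hat G$ with vertex set $V\sqcup V_X\sqcup V_Y$ and edge set $E\sqcup E_X\sqcup E_Y$, extending $G$, with a vector $\hat{\mathbf a}$, such that 1. the edges of $E_X$ go from $V_X$ to $\{i\in V:\mathbf a_i>0\}$, and exactly $\mathbf a_i$ of them end at each $i\in V$ with $\mathbf a_i>0$; 2. the edges of $E_Y$ go from $\{i\in V:\mathbf a_i<0\}$ to $V_Y$, and at least $1$ and at most $|\mathbf a_i|$ of them start at each $i\in V$ with $\mathbf a_i<0$; 3. each vertex of $V_X$ (resp. $V_Y$) is incident to exactly one edge of $E_X$ (resp. $E_Y$); 4. $\hat{\mathbf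 a}$ is $0$ on $V$, is $1$ on $V_X$, takes negative integer values on $V_Y$, and satisfies $\mathbf a_i=\sum_{y\in E_Y,\,t(y)=i}\hat{\mathbf a}_{h(y)}$ whenever $\mathbf a_i<0$. A *framing* $\hat{\mathfrak F}$ of it consists of total orders, for each $i\in V$, on the edges of $\hat G$ leaving $i$ and on the edges of $\hat G$ entering $i$, and of a total order on $V_X$. **Routes.** A *route* is a directed path of $\hat G$ from a source (a vertex without incoming edges) to a sink (a vertex without outgoing edges). For distinct paths $p,q$ from a vertex $i$ to sinks, $p<_i^+q$ means that, at the first vertex where they diverge, the edge taken by $p$ is smaller in the order on outgoing edges than the edge taken by $q$. For distinct paths from sources to $i$, $p<_i^-q$ is defined dually, by the order on the incoming edges at the last vertex where they merge. For routes through $i$, the two relations compare their parts after, respectively before, $i$. Routes $p,q$ are *incompatible* if, at some common vertex $i$, $p<_i^-q$ and $q<_i^+p$, or $q<_i^-p$ and $p<_i^+q$. A *route-clique* is a set of pairwise compatible routes. **Layerings.** A *layering* is a set $L$ of routes such that exactly $\hat{\mathbf a}_i$ routes of $L$ start at each source $i$ of $\hat G$ and exactly $|\hat{\mathbf a}_j|$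 routes of $L$ end at each sink $j$ of $\hat G$. In particular $L$ has exactly one route $L_s$ starting at each $s\in V_X$. Layerings are totally ordered as follows: $L<M$ if $L_s<_s^+M_s$ for the greatest $s\in V_X$ with $L_s\ne M_s$. For a set of layerings, $\mathrm{routes}(\cdot)$ denotes the set of all routes belonging to its members. A set $\mathcal L=\{L^1<\dots<L^m\}$ of layerings ($m\ge0$) is a *layering-simplex* if 1. $\mathrm{routes}(\mathcal L)$ is a route-clique; 2. for each $i\in[m]$, $L^i$ is the smallest layering all of whose routes lie in $\mathrm{routes}(\{L^i,\dots,L^m\})$; 3. for each $i\in[m]$, some route of $L^i$ is not in $\mathrm{routes}(\{L^{i+1},\dots,L^m\})$. For a layering $L$ let $\check{\mathcal J}(L)\in\mathbb R^E$ be the vector whose entry at $e\in E$ is the number of routes of $L$ that use $e$, and let $\check\Delta_1(\mathcal L)=\mathrm{conv}\{\check{\mathcal J}(L):L\in\mathcal L\}$. **Theorem.** Let $G$ be a finite DAG with nonzero integer netflow vector $\mathbf a$, and let $(\hat G,\hat{\mathbf a},\hat{\mathfrak F})$ be a framed augmentation of $(G,\mathbf a)$. Then $$\mathcal T(\hat G,\hat{\mathbf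 a},\hat{\mathfrak F})=\{\check\Delta_1(\mathcal L):\mathcal L\text{ a layering-simplex}\}$$ is a unimodular lattice triangulation of $\mathcal F_G(\mathbf a)$. That is, $\mathcal F_G(\mathbf a)$ is a (possibly empty) polytope with integer vertices, $\mathcal T$ is a finite set of (possibly empty) simplices with integer vertices whose union is $\mathcal F_G(\mathbf a)$, every (possibly empty) face of a member of $\mathcal T$ is in $\mathcal T$, the intersection of any two members is a (possibly empty) face of both, and each nonempty member of $\mathcal T$ has normalized volume $1$ within its affine span. Here the normalized volume of a $d$-dimensional simplex is $d!$ times its volume, measured so that the lattice of integer points of the linear subspace parallel to its affine span has covolume $1$. -/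

import Mathlib

/-! ### Directed multigraphs, paths, routes and flows -/

/-- A directed graph with vertex set `V` and edge set `E`; parallel edges are allowed. -/
structure MultiDigraph (V E : Type*) where
  tail : E → V
  head : E → V

namespace MultiDigraph

variable {V E : Type*}

/-- `G.IsPath u l v`: the list of edges `l` is a directed path of `G` from `u` to `v`. -/
def IsPath (G : MultiDigraph V E) : V → List E → V → Prop
  | u, [], v => u = v
  | u, e :: l, v => G.tail e = u ∧ G.IsPath (G.head e) l v

/-- `G` is a DAG: it has no nonempty closed directed path. -/
def IsDAG (G : MultiDigraph V E) : Prop :=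
  ∀ (v : V) (l : List E), G.IsPath v l v → l = []

def IsSource (G : MultiDigraph V E) (v : V) : Prop := ∀ e, G.head e ≠ v

def IsSink (G : MultiDigraph V E) (v : V) : Prop := ∀ e, G.tail e ≠ v

/-- A route: a directed path from a source to a sink. -/
@[ext]
structure Route (G : MultiDigraph V E) where
  start : V
  finish : V
  edges : List E
  isPath : G.IsPath start edges finish
  isSource_start : G.IsSource start
  isSink_finish : G.IsSink finish

/-- The route `p` passes through `i`, following the edges of `l₁` before `i` and the edges of
`l₂` after `i`. -/
def Route.SplitsAt {G : MultiDigraph V E} (p : G.Route) (i : V) (l₁ l₂ : List E) : Prop :=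
  p.edges = l₁ ++ l₂ ∧ G.IsPath p.start l₁ i ∧ G.IsPath i l₂ p.finish

open Classical in
/-- The polytope of nonnegative `a`-flows of `G`. -/
def flowPolytope [Fintype E] (G : MultiDigraph V E) (a : V → ℤ) : Set (E → ℝ) :=
  {F | (∀ e, 0 ≤ F e) ∧
    ∀ i, (∑ e with G.tail e = i, F e) - (∑ e with G.head e = i, F e) = (a i : ℝ)}

end MultiDigraph

/-! ### Augmentations and their framings -/

open Classical in
/-- An augmentation of `(G, a)` with inflow vertices `VX`, inflow edges `EX`, outflow vertices
`VY` and outflow edges `EY`. -/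
structure Augmentation {V E : Type*} (G : MultiDigraph V E) (a : V → ℤ)
    (VX VY EX EY : Type*) [Fintype EX] [Fintype EY] where
  xTail : EX → VX
  xHead : EX → V
  yTail : EY → V
  yHead : EY → VY
  /-- inflow edges end at vertices of positive netflow, `a i` of them at each such vertex `i` -/
  xHead_pos : ∀ x, 0 < a (xHead x)
  card_xHead : ∀ i, 0 < a i → ((Finset.univ.filter fun x => xHead x = i).card : ℤ) = a i
  /-- outflow edges start at vertices of negative netflow, between `1` and `|a i|` of them at each
  such vertex `i` -/
  yTail_neg : ∀ y, a (yTail y) < 0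
  one_le_card_yTail : ∀ i, a i < 0 → 1 ≤ (Finset.univ.filter fun y => yTail y = i).card
  card_yTail_le : ∀ i, a i < 0 → ((Finset.univ.filter fun y => yTail y = i).card : ℤ) ≤ |a i|
  /-- every inflow (outflow) vertex is incident to precisely one inflow (outflow) edge -/
  existsUnique_x : ∀ v : VX, ∃! x, xTail x = v
  existsUnique_y : ∀ v : VY, ∃! y, yHead y = v
  /-- the netflow at the outflow vertices -/
  aY : VY → ℤ
  aY_neg : ∀ v, aY v < 0
  sum_aY : ∀ i, a i < 0 → a i = ∑ y with yTail y = i, aY (yHead y)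

namespace Augmentation

variable {V E VX VY EX EY : Type*} [Fintype EX] [Fintype EY]
  {G : MultiDigraph V E} {a : V → ℤ}

/-- The augmented graph, with vertex set `V ⊔ VX ⊔ VY` and edge set `E ⊔ EX ⊔ EY`. -/
def graph (A : Augmentation G a VX VY EX EY) : MultiDigraph (V ⊕ VX ⊕ VY) (E ⊕ EX ⊕ EY) where
  tail
    | .inl e => .inl (G.tail e)
    | .inr (.inl x) => .inr (.inl (A.xTail x))
    | .inr (.inr y) => .inl (A.yTail y)
  head
    | .inl e => .inl (G.head e)
    | .inr (.inl x) => .inl (A.xHead x)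
    | .inr (.inr y) => .inr (.inr (A.yHead y))

/-- The netflow vector of the augmented graph. -/
def netflow (A : Augmentation G a VX VY EX EY) : V ⊕ VX ⊕ VY → ℤ
  | .inl _ => 0
  | .inr (.inl _) => 1
  | .inr (.inr v) => A.aY v

/-- A framing: total orders on the outgoing and on the incoming edges (in the augmented graph) of
each vertex of `V`, and a total order on the inflow vertices. -/
structure Framing (A : Augmentation G a VX VY EX EY) where
  out : ∀ i : V, LinearOrder {e : E ⊕ EX ⊕ EY // A.graph.tail e = .inl i}
  inc : ∀ i : V, LinearOrder {e : E ⊕ EX ⊕ EY // A.graph.head e = .inl i}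
  src : LinearOrder VX

namespace Framing

variable {A : Augmentation G a VX VY EX EY}

/-- `f` and `g` leave a common vertex of `V`, and `f` is smaller in the order there. -/
def OutLT (F : A.Framing) (f g : E ⊕ EX ⊕ EY) : Prop :=
  ∃ (i : V) (hf : A.graph.tail f = .inl i) (hg : A.graph.tail g = .inl i),
    (F.out i).lt ⟨f, hf⟩ ⟨g, hg⟩

/-- `f` and `g` enter a common vertex of `V`, and `f` is smaller in the order there. -/
def IncLT (F : A.Framing) (f g : E ⊕ EX ⊕ EY) : Prop :=
  ∃ (i : V) (hf : A.graph.head f = .inl i) (hg : A.graph.head g = .inl i),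
    (F.inc i).lt ⟨f, hf⟩ ⟨g, hg⟩

/-- The post-`i` order, for paths `p` and `q` from a common vertex `i` to sinks. -/
def PostLT (F : A.Framing) (p q : List (E ⊕ EX ⊕ EY)) : Prop :=
  ∃ σ f g p' q', p = σ ++ f :: p' ∧ q = σ ++ g :: q' ∧ F.OutLT f g

/-- The pre-`i` order, for paths `p` and `q` from sources to a common vertex `i`. -/
def PreLT (F : A.Framing) (p q : List (E ⊕ EX ⊕ EY)) : Prop :=
  ∃ σ f g p' q', p = p' ++ f :: σ ∧ q = q' ++ g :: σ ∧ F.IncLT f g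

/-- `p` and `q` share a vertex `i` at which `p <⁻ q` and `q <⁺ p`. -/
def Cross (F : A.Framing) (p q : A.graph.Route) : Prop :=
  ∃ i p₁ p₂ q₁ q₂, p.SplitsAt i p₁ p₂ ∧ q.SplitsAt i q₁ q₂ ∧ F.PreLT p₁ q₁ ∧ F.PostLT q₂ p₂

def Compatible (F : A.Framing) (p q : A.graph.Route) : Prop := ¬ F.Cross p q ∧ ¬ F.Cross q p

def IsRouteClique (F : A.Framing) (R : Set A.graph.Route) : Prop :=
  ∀ p ∈ R, ∀ q ∈ R, F.Compatible p q

end Framing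

open Classical in
/-- A layering: a set of routes of the augmented graph, with as many routes starting at each source
and ending at each sink as the netflow vector prescribes. (A source or sink that lies in `V` has
netflow `0`.) -/
def IsLayering (A : Augmentation G a VX VY EX EY) (L : Finset A.graph.Route) : Prop :=
  (∀ i, A.graph.IsSource i → ((L.filter fun p => p.start = i).card : ℤ) = A.netflow i) ∧
  (∀ j, A.graph.IsSink j → ((L.filter fun p => p.finish = j).card : ℤ) = |A.netflow j|)

/-- The set of routes used by a set of layerings. -/
def routes (A : Augmentation G a VX VY EX EY) (S : Set (Finset A.graph.Route)) :
    Set A.graph.Route :=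
  {p | ∃ L ∈ S, p ∈ L}

/-- The post-source order on layerings: at the greatest inflow vertex `s` where `L` and `M` have
different routes, the route of `L` is smaller than that of `M` in the post-`s` order. -/
def Framing.SrcLT {A : Augmentation G a VX VY EX EY} (F : A.Framing)
    (L M : Finset A.graph.Route) : Prop :=
  ∃ s : VX,
    (∃ p ∈ L, ∃ q ∈ M, p.start = .inr (.inl s) ∧ q.start = .inr (.inl s) ∧
      F.PostLT p.edges q.edges) ∧
    ∀ s' : VX, F.src.lt s s' → ∀ p ∈ L, ∀ q ∈ M,
      p.start = .inr (.inl s') → q.start = .inr (.inl s') → p = q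

/-- A layering-simplex. If `S = {L¹ < ⋯ < Lᵐ}` and `L = Lⁱ`, then `{N ∈ S | N = L ∨ L < N}` is
`{Lⁱ, …, Lᵐ}` and `{N ∈ S | L < N}` is `{Lⁱ⁺¹, …, Lᵐ}`. -/
structure Framing.IsLayeringSimplex {A : Augmentation G a VX VY EX EY} (F : A.Framing)
    (S : Finset (Finset A.graph.Route)) : Prop where
  isLayering : ∀ L ∈ S, A.IsLayering L
  isRouteClique : F.IsRouteClique (A.routes S)
  isMin : ∀ L ∈ S, ∀ M, A.IsLayering M →
    (∀ p ∈ M, p ∈ A.routes {N | N ∈ S ∧ (N = L ∨ F.SrcLT L N)}) → M = L ∨ F.SrcLT L M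
  exists_new : ∀ L ∈ S, ∃ p ∈ L, p ∉ A.routes {N | N ∈ S ∧ F.SrcLT L N}

open Classical in
/-- The deaugmented indicator vector of a route. -/
noncomputable def routeIndicator (A : Augmentation G a VX VY EX EY) (p : A.graph.Route) : E → ℝ :=
  fun e => if Sum.inl e ∈ p.edges then 1 else 0

/-- The deaugmented indicator vector of a layering. -/
noncomputable def layeringIndicator (A : Augmentation G a VX VY EX EY)
    (L : Finset A.graph.Route) : E → ℝ :=
  ∑ p ∈ L, A.routeIndicator p

/-- The deaugmented polyhedral simplex of a set of layerings. -/
noncomputable def polyhedralSimplex (A : Augmentation G a VX VY EX EY)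
    (S : Finset (Finset A.graph.Route)) : Set (E → ℝ) :=
  convexHull ℝ (A.layeringIndicator '' S)

/-- The collection of the deaugmented polyhedral simplices of all layering-simplices. -/
def Framing.triangulation {A : Augmentation G a VX VY EX EY} (F : A.Framing) :
    Set (Set (E → ℝ)) :=
  {Δ | ∃ S, F.IsLayeringSimplex S ∧ Δ = A.polyhedralSimplex S}

end Augmentation

/-! ### Unimodular lattice triangulations -/

section Triangulation

variable {E : Type*}

def IsIntegerPoint (x : E → ℝ) : Prop := ∀ e, ∃ n : ℤ, x e = n

/-- A (possibly empty) integer polytope. -/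
def IsIntegerPolytope (P : Set (E → ℝ)) : Prop :=
  ∃ s : Finset (E → ℝ), (∀ x ∈ s, IsIntegerPoint x) ∧ P = convexHull ℝ (s : Set (E → ℝ))

/-- `s` is the vertex set of the (possibly empty) simplex `Δ`. -/
def IsVertexSet (s : Finset (E → ℝ)) (Δ : Set (E → ℝ)) : Prop :=
  AffineIndependent ℝ ((↑) : s → E → ℝ) ∧ Δ = convexHull ℝ (s : Set (E → ℝ))

def IsIntegerSimplex (Δ : Set (E → ℝ)) : Prop :=
  ∃ s : Finset (E → ℝ), (∀ x ∈ s, IsIntegerPoint x) ∧ IsVertexSet s Δ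

/-- `Δ'` is a (possibly empty) face of the simplex `Δ`. -/
def IsSimplexFace (Δ' Δ : Set (E → ℝ)) : Prop :=
  ∃ s t : Finset (E → ℝ), IsVertexSet s Δ ∧ t ⊆ s ∧ Δ' = convexHull ℝ (t : Set (E → ℝ))

structure IsLatticeTriangulation (P : Set (E → ℝ)) (T : Set (Set (E → ℝ))) : Prop where
  isIntegerPolytope : IsIntegerPolytope P
  finite : T.Finite
  isIntegerSimplex : ∀ Δ ∈ T, IsIntegerSimplex Δ
  eq_sUnion : P = ⋃₀ T
  face_mem : ∀ Δ ∈ T, ∀ Δ', IsSimplexFace Δ' Δ → Δ' ∈ T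
  inter_face : ∀ Δ₁ ∈ T, ∀ Δ₂ ∈ T, IsSimplexFace (Δ₁ ∩ Δ₂) Δ₁ ∧ IsSimplexFace (Δ₁ ∩ Δ₂) Δ₂

/-- The lattice of integer points of a linear subspace. -/
def integerPoints (W : Submodule ℝ (E → ℝ)) : Submodule ℤ W where
  carrier := {w | IsIntegerPoint (w : E → ℝ)}
  zero_mem' := fun _ => ⟨0, by simp⟩
  add_mem' := fun {v w} hv hw e => by
    obtain ⟨m, hm⟩ := hv e
    obtain ⟨n, hn⟩ := hw e
    exact ⟨m + n, by simp [hm, hn]⟩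
  smul_mem' := fun c w hw e => by
    obtain ⟨n, hn⟩ := hw e
    exact ⟨c * n, by simp [hn]⟩

set_option synthInstance.maxHeartbeats 200000 in
/-- The volume of a subset of a linear subspace `W`, in units of the covolume of the lattice of
integer points of `W`. (The quotient does not depend on the choice of the Haar measure on `W`.) -/
noncomputable def latticeVolume [Fintype E] (W : Submodule ℝ (E → ℝ)) (S : Set W) : ℝ :=
  (MeasureTheory.Measure.addHaar : MeasureTheory.Measure W).real S /
    ZLattice.covolume (integerPoints W) (MeasureTheory.Measure.addHaar : MeasureTheory.Measure W)

/-- The normalized volume of a `d`-dimensional set `Δ` within its affine span, where `x` is a point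
of that span: `d!` times the lattice volume of the translate `Δ - x` in the linear subspace parallel
to the span. -/
noncomputable def normalizedVolume [Fintype E] (Δ : Set (E → ℝ)) (x : E → ℝ) : ℝ :=
  (Module.finrank ℝ (vectorSpan ℝ Δ)).factorial *
    latticeVolume (vectorSpan ℝ Δ) {w | x + (w : E → ℝ) ∈ Δ}

/-- A lattice triangulation is unimodular if each (nonempty) simplex has normalized volume `1`
within its affine span. -/
structure IsUnimodularTriangulation [Fintype E] (P : Set (E → ℝ)) (T : Set (Set (E → ℝ))) : Prop
    extends IsLatticeTriangulation P T where
  normalizedVolume_eq_one : ∀ Δ ∈ T, ∀ x ∈ Δ, normalizedVolume Δ x = 1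

end Triangulation

/-! Extend a point of the flow polytope to the augmented graph by the flow `1` on each inflow edge
and `|aY|` on each outflow edge. The result is conserved at every vertex of `V`. The proof
decomposes it in two stages, each of them existing and being unique: first into pairwise compatible
routes, then into layerings.

Routes. Stack the incoming and the outgoing edges of each vertex in framing order, as intervals
whose lengths are their flows, and let points pass from incoming to outgoing edges at equal height.
The points following a given route form a half-open interval, whose length is the weight of that
route. These weights sum to the flow on every edge (`sum_followWeight`), and routes of positive
weight do not cross, because points keep their order along a common subpath
(`not_crosses_of_follows`). Conversely, in any noncrossing decomposition of a flow, the routes can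
be stacked inside the edges so that each route occupies an interval carried along by the motion. So
every decomposition has these weights on the routes with at least one edge (`eq_followWeight`).

Layerings. The route weights act as a fractional perfect matching between inflow vertices and places
at outflow vertices, so Hall's theorem yields a layering inside their support
(`IsBalanced.exists_layering`). Choosing the least one, subtracting it with the largest possible
coefficient and repeating produces a layering-simplex (`exists_layerSum_eq`). In any
layering-simplex the least member is determined by the set of its routes, and the coefficient of
that member is the smallest weight among the member's routes. Hence the greedy decomposition is the
only one (`IsLayeringSimplex.unique`).

Thus every point of the polytope is a positive combination of the members of exactly one
layering-simplex. Subsets of layering-simplices are layering-simplices, so this uniqueness gives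
affine independence and the intersection property. If a flow is integral, all interval endpoints are
integers, hence so are the route weights and, peeling off least layerings, the coefficients
(`integer_of_sum`). So the edge vectors of each simplex form a basis of the lattice in its direction
space, which is unimodularity. `UniqueCombinations.isUnimodularTriangulation` carries out this last,
purely convex-geometric passage. -/

/-! ### Lexicographic comparison of lists -/

/-- `p` and `q` differ at some first position, and the entry of `p` there is smaller. -/
def LexLT {E : Type*} (r : E → E → Prop) (p q : List E) : Prop :=
  ∃ σ f g p' q', p = σ ++ f :: p' ∧ q = σ ++ g :: q' ∧ r f g

namespace LexLT

variable {E : Type*} {r : E → E → Prop}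

theorem not_nil_left (q : List E) : ¬ LexLT r [] q := by
  rintro ⟨σ, f, g, p', q', h, -⟩
  simp at h

theorem not_nil_right (p : List E) : ¬ LexLT r p [] := by
  rintro ⟨σ, f, g, p', q', -, h, -⟩
  simp at h

theorem cons_iff {x y : E} {p q : List E} :
    LexLT r (x :: p) (y :: q) ↔ r x y ∨ (x = y ∧ LexLT r p q) := by
  constructor
  · rintro ⟨σ, f, g, p', q', hp, hq, h⟩
    cases σ with
    | nil =>
      simp only [List.nil_append, List.cons.injEq] at hp hq
      rw [hp.1, hq.1]
      exact Or.inl h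
    | cons z σ =>
      simp only [List.cons_append, List.cons.injEq] at hp hq
      exact Or.inr ⟨hp.1.trans hq.1.symm, σ, f, g, p', q', hp.2, hq.2, h⟩
  · rintro (h | ⟨rfl, σ, f, g, p', q', rfl, rfl, h⟩)
    · exact ⟨[], x, y, p, q, rfl, rfl, h⟩
    · exact ⟨x :: σ, f, g, p', q', rfl, rfl, h⟩

theorem append_left (l : List E) {p q : List E} (h : LexLT r p q) : LexLT r (l ++ p) (l ++ q) := by
  obtain ⟨σ, f, g, p', q', rfl, rfl, h⟩ := h
  exact ⟨l ++ σ, f, g, p', q', by simp, by simp, h⟩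

theorem irrefl (hr : ∀ e, ¬ r e e) (p : List E) : ¬ LexLT r p p := by
  induction p with
  | nil => exact not_nil_left _
  | cons e p ih =>
    rw [cons_iff]
    rintro (h | ⟨-, h⟩)
    · exact hr _ h
    · exact ih h

theorem trans (hr : ∀ e f g, r e f → r f g → r e g) {p q s : List E}
    (h : LexLT r p q) (h' : LexLT r q s) : LexLT r p s := by
  induction p generalizing q s with
  | nil => exact (not_nil_left _ h).elim
  | cons e p ih =>
    cases q with
    | nil => exact (not_nil_right _ h).elim
    | cons f q =>
      cases s with
      | nil => exact (not_nil_right _ h').elim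
      | cons g s =>
        rw [cons_iff] at h h' ⊢
        rcases h with h | ⟨rfl, h⟩ <;> rcases h' with h' | ⟨rfl, h'⟩
        · exact Or.inl (hr _ _ _ h h')
        · exact Or.inl h
        · exact Or.inl h'
        · exact Or.inr ⟨rfl, ih h h'⟩

end LexLT

/-! ### Paths in directed acyclic graphs -/

namespace MultiDigraph

variable {V E : Type*} {G : MultiDigraph V E}

/-- The graph with all edges reversed. -/
def reverse (G : MultiDigraph V E) : MultiDigraph V E where
  tail := G.head
  head := G.tail

theorem isPath_append {u v : V} {l₁ l₂ : List E} :
    G.IsPath u (l₁ ++ l₂) v ↔ ∃ w, G.IsPath u l₁ w ∧ G.IsPath w l₂ v := by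
  induction l₁ generalizing u with
  | nil => simp [IsPath]
  | cons e l ih => simp [IsPath, ih, and_assoc]

theorem IsPath.reverse {u v : V} {l : List E} (h : G.IsPath u l v) :
    G.reverse.IsPath v l.reverse u := by
  induction l generalizing u with
  | nil => exact Eq.symm h
  | cons e l ih =>
    rw [List.reverse_cons, isPath_append]
    exact ⟨G.head e, ih h.2, rfl, h.1⟩

theorem IsPath.finish_unique {u v w : V} {l : List E} (h : G.IsPath u l v) (h' : G.IsPath u l w) :
    v = w := by
  induction l generalizing u with
  | nil => exact (Eq.symm h).trans h'
  | cons e l ih => exact ih h.2 h'.2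

theorem IsDAG.reverse (hG : G.IsDAG) : G.reverse.IsDAG := fun v l h =>
  List.reverse_eq_nil_iff.1 (hG v l.reverse h.reverse)

theorem IsDAG.eq_nil (hG : G.IsDAG) {u v : V} {l l' : List E} (h : G.IsPath u l v)
    (h' : G.IsPath v l' u) : l = [] :=
  (List.append_eq_nil_iff.1 (hG u (l ++ l') (isPath_append.2 ⟨v, h, h'⟩))).1

theorem IsDAG.nodup (hG : G.IsDAG) {u v : V} {l : List E} (h : G.IsPath u l v) : l.Nodup := by
  induction l generalizing u with
  | nil => exact List.nodup_nil
  | cons e l ih =>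
    refine List.nodup_cons.2 ⟨fun he => ?_, ih h.2⟩
    obtain ⟨l₁, l₂, rfl⟩ := List.append_of_mem he
    obtain ⟨w, h₁, h₂⟩ := isPath_append.1 h.2
    have := hG.eq_nil (l := [e]) (u := G.tail e) ⟨rfl, rfl⟩ (h₂.1 ▸ h₁)
    simp at this

/-- Every vertex of a path of an acyclic graph is visited once. -/
theorem IsDAG.split_unique (hG : G.IsDAG) {u v w : V} {l₁ l₂ l₁' l₂' : List E}
    (h : l₁ ++ l₂ = l₁' ++ l₂') (h₁ : G.IsPath u l₁ w) (h₁' : G.IsPath u l₁' w)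
    (h₂ : G.IsPath w l₂ v) (h₂' : G.IsPath w l₂' v) : l₁ = l₁' ∧ l₂ = l₂' := by
  rcases List.append_eq_append_iff.1 h with ⟨m, rfl, rfl⟩ | ⟨m, rfl, rfl⟩
  · obtain ⟨x, hx, hx'⟩ := isPath_append.1 h₁'
    obtain rfl := h₁.finish_unique hx
    obtain rfl := hG _ _ hx'
    simp
  · obtain ⟨x, hx, hx'⟩ := isPath_append.1 h₁
    obtain rfl := h₁'.finish_unique hx
    obtain rfl := hG _ _ hx'
    simp

/-- In a finite acyclic graph, properties of vertices can be proved by induction from the sinks. -/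
theorem IsDAG.induction [Finite V] (hG : G.IsDAG) {P : V → Prop}
    (h : ∀ v, (∀ e, G.tail e = v → P (G.head e)) → P v) (v : V) : P v := by
  -- Reachability by a nonempty path is irreflexive by acyclicity, and so well-founded on a finite
  -- vertex set.
  let r : V → V → Prop := fun w v => ∃ l, l ≠ [] ∧ G.IsPath v l w
  have : IsTrans V r := ⟨by
    rintro a b c ⟨l, hl, h⟩ ⟨l', hl', h'⟩
    exact ⟨l' ++ l, by simp [hl], isPath_append.2 ⟨b, h', h⟩⟩⟩
  have : Std.Irrefl r := ⟨fun v ⟨l, hl, h⟩ => hl (hG v l h)⟩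
  have wf := Finite.wellFounded_of_trans_of_irrefl r
  induction v using wf.induction with
  | h v ih => exact h v fun e he => ih _ ⟨[e], by simp, he, rfl⟩

/-- A route of the reversed graph. -/
def Route.reverse (p : G.Route) : G.reverse.Route where
  start := p.finish
  finish := p.start
  edges := p.edges.reverse
  isPath := p.isPath.reverse
  isSource_start := p.isSink_finish
  isSink_finish := p.isSource_start

/-- Nonemptiness is essential: an isolated vertex carries a route without edges, which its edge list
does not locate. -/
theorem Route.ext_edges {p q : G.Route} (hp : p.edges ≠ []) (h : p.edges = q.edges) : p = q := by
  have hs : p.start = q.start := by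
    have h₁ := p.isPath
    have h₂ := q.isPath
    rw [← h] at h₂
    cases he : p.edges with
    | nil => exact (hp he).elim
    | cons e l =>
      rw [he] at h₁ h₂
      exact h₁.1.symm.trans h₂.1
  refine Route.ext hs ?_ h
  have h₂ := q.isPath
  rw [← h, ← hs] at h₂
  exact p.isPath.finish_unique h₂

theorem Route.ext_of_start {p q : G.Route} (hs : p.start = q.start) (h : p.edges = q.edges) :
    p = q := by
  refine Route.ext hs ?_ h
  have h₂ := q.isPath
  rw [← h, ← hs] at h₂
  exact p.isPath.finish_unique h₂

/-- Acyclicity forbids repeated edges, and a finite type has finitely many lists without repetition.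
-/
theorem IsDAG.finite_route [Finite V] [Finite E] (hG : G.IsDAG) : Finite G.Route := by
  classical
  have := Fintype.ofFinite E
  refine Finite.of_injective
    (fun p : G.Route => (p.start, (⟨p.edges, hG.nodup p.isPath⟩ : {l : List E // l.Nodup})))
    fun p q h => ?_
  simp only [Prod.mk.injEq, Subtype.mk.injEq] at h
  exact Route.ext_of_start h.1 h.2

end MultiDigraph

/-! ### Orders on the fibres of a map -/

/-- `r` is a strict total order on each fibre of `t`, and relates no elements of different
fibres. -/
structure IsFiberOrder {V E : Type*} (t : E → V) (r : E → E → Prop) : Prop where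
  eq_of_lt : ∀ e f, r e f → t e = t f
  irrefl : ∀ e, ¬ r e e
  trans : ∀ e f g, r e f → r f g → r e g
  total : ∀ e f, t e = t f → e = f ∨ r e f ∨ r f e

open Classical in
/-- The total weight of the elements below `e`. -/
noncomputable def offset {E : Type*} [Fintype E] (r : E → E → Prop) (F : E → ℝ) (e : E) : ℝ :=
  ∑ g with r g e, F g

namespace IsFiberOrder

variable {V E : Type*} [Fintype E] {t : E → V} {r : E → E → Prop} {F : E → ℝ}

theorem offset_nonneg (hF : ∀ e, 0 ≤ F e) (e : E) : 0 ≤ offset r F e :=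
  Finset.sum_nonneg fun _ _ => hF _

theorem offset_add_le (h : IsFiberOrder t r) (hF : ∀ e, 0 ≤ F e) {g e : E} (hge : r g e) :
    offset r F g + F g ≤ offset r F e := by
  classical
  have hg : g ∉ Finset.univ.filter fun x => r x g := by simpa using h.irrefl g
  rw [offset, add_comm, ← Finset.sum_insert hg]
  refine Finset.sum_le_sum_of_subset_of_nonneg (fun x hx => ?_) fun _ _ _ => hF _
  simp only [Finset.mem_insert, Finset.mem_filter, Finset.mem_univ, true_and] at hx ⊢
  rcases hx with rfl | hx
  · exact hge
  · exact h.trans _ _ _ hx hge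

open Classical in
theorem offset_add_le_sum (h : IsFiberOrder t r) (hF : ∀ e, 0 ≤ F e) (e : E) :
    offset r F e + F e ≤ ∑ g with t g = t e, F g := by
  have he : e ∉ Finset.univ.filter fun x => r x e := by simpa using h.irrefl e
  rw [offset, add_comm, ← Finset.sum_insert he]
  refine Finset.sum_le_sum_of_subset_of_nonneg (fun x hx => ?_) fun _ _ _ => hF _
  simp only [Finset.mem_insert, Finset.mem_filter, Finset.mem_univ, true_and] at hx ⊢
  rcases hx with rfl | hx
  · rfl
  · exact h.eq_of_lt _ _ hx

theorem eq_of_mem_Ico (h : IsFiberOrder t r) (hF : ∀ e, 0 ≤ F e) {e f : E} (hef : t e = t f)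
    {y : ℝ} (he : offset r F e ≤ y ∧ y < offset r F e + F e)
    (hf : offset r F f ≤ y ∧ y < offset r F f + F f) : e = f := by
  rcases h.total e f hef with h' | h' | h'
  · exact h'
  · linarith [h.offset_add_le hF h']
  · linarith [h.offset_add_le hF h']

/-- Remove a maximal element `m` from the lower set `D`: what remains is exactly the set of elements
below `m`, with total weight the offset of `m`. So either `y` lies in the interval of `m`, or the
smaller lower set applies. -/
theorem exists_mem_Ico_of_lower (h : IsFiberOrder t r) {v : V} {y : ℝ} (hy : 0 ≤ y) (n : ℕ)
    (D : Finset E) (hn : D.card = n) (hD : ∀ e ∈ D, t e = v) (hl : ∀ e ∈ D, ∀ g, r g e → g ∈ D)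
    (hlt : y < ∑ e ∈ D, F e) : ∃ e ∈ D, offset r F e ≤ y ∧ y < offset r F e + F e := by
  classical
  induction n generalizing D with
  | zero =>
    rw [Finset.card_eq_zero] at hn
    subst hn
    simp at hlt
    linarith
  | succ n ih =>
    have hne : D.Nonempty := Finset.card_pos.1 (by omega)
    have : IsTrans E (fun a b => r b a) := ⟨fun a b c hab hbc => h.trans _ _ _ hbc hab⟩
    have : Std.Irrefl (fun a b => r b a) := ⟨h.irrefl⟩
    obtain ⟨m, hm, hmax⟩ :=
      (Finite.wellFounded_of_trans_of_irrefl (fun a b => r b a)).has_min (D : Set E) hne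
    have hlow : ∀ x, x ∈ D.erase m ↔ r x m := by
      intro x
      rw [Finset.mem_erase]
      constructor
      · rintro ⟨hxm, hx⟩
        rcases h.total x m ((hD x hx).trans (hD m hm).symm) with h' | h' | h'
        · exact (hxm h').elim
        · exact h'
        · exact (hmax x hx h').elim
      · intro hx
        exact ⟨fun hxm => h.irrefl m (hxm ▸ hx), hl m hm x hx⟩
    have hoff : offset r F m = ∑ e ∈ D.erase m, F e := by
      rw [offset]
      congr 1
      ext x
      simp [← hlow]
    by_cases hym : offset r F m ≤ y
    · refine ⟨m, hm, hym, ?_⟩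
      rwa [hoff, Finset.sum_erase_add _ _ hm]
    · obtain ⟨e, he, h'⟩ := ih (D.erase m) (by rw [Finset.card_erase_of_mem hm]; omega)
        (fun e he => hD e (Finset.mem_of_mem_erase he))
        (fun e he g hg => (hlow g).2 (h.trans _ _ _ hg ((hlow e).1 he)))
        (by rw [← hoff]; exact not_le.1 hym)
      exact ⟨e, Finset.mem_of_mem_erase he, h'⟩

open Classical in
-- Together with `eq_of_mem_Ico`, this says that the stacked intervals of a fibre tile the heights
-- from `0` to the total weight.
theorem exists_mem_Ico (h : IsFiberOrder t r) {v : V} {y : ℝ} (hy : 0 ≤ y)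
    (hlt : y < ∑ e with t e = v, F e) :
    ∃ e, t e = v ∧ offset r F e ≤ y ∧ y < offset r F e + F e := by
  obtain ⟨e, he, h'⟩ := h.exists_mem_Ico_of_lower (v := v) hy _ _ rfl (by simp)
    (fun e he g hg => by
      have := h.eq_of_lt _ _ hg
      simp_all) hlt
  exact ⟨e, by simpa using he, h'⟩

end IsFiberOrder

/-! ### The dynamics of a flow on a framed graph

A flow `F` lets the points of `[0, F e)` move along the edge `e`. At each vertex the incoming and
the outgoing edges are stacked in their order, and a point of an incoming edge goes on along the
outgoing edge at the same height. -/

section Dynamics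

variable {E : Type*}

/-- The point at height `y` follows the edges of the list, where the edge `e` occupies the
heights from `b e` at its tail and from `a e` at its head. -/
def Follows (a b F : E → ℝ) : ℝ → List E → Prop
  | _, [] => True
  | y, e :: l => (b e ≤ y ∧ y < b e + F e) ∧ Follows a b F (y - b e + a e) l

/-- The change of height along a list of edges. -/
def drift (a b : E → ℝ) (l : List E) : ℝ := (l.map fun e => a e - b e).sum

variable {a b F : E → ℝ}

theorem follows_append {y : ℝ} {l₁ l₂ : List E} :
    Follows a b F y (l₁ ++ l₂) ↔ Follows a b F y l₁ ∧ Follows a b F (y + drift a b l₁) l₂ := by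
  induction l₁ generalizing y with
  | nil => simp [Follows, drift]
  | cons e l ih =>
    have : y - b e + a e + drift a b l = y + drift a b (e :: l) := by
      simp [drift]
      ring
    simp [Follows, ih, this, and_assoc]

/-- Running the motion backwards exchanges the heights at heads and tails; this is the motion on the
reversed graph, so forward results also apply backwards. -/
theorem follows_reverse {y : ℝ} {l : List E} :
    Follows b a F (y + drift a b l) l.reverse ↔ Follows a b F y l := by
  induction l generalizing y with
  | nil => simp [Follows]
  | cons e l ih =>
    have h₁ : y + drift a b (e :: l) = y - b e + a e + drift a b l := by
      simp [drift]
      ring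
    have h₂ : drift b a l.reverse = - drift a b l := by
      simp only [drift, List.map_reverse, List.sum_reverse]
      rw [List.sum_neg, List.map_map]
      congr 2
      ext
      simp
    rw [List.reverse_cons, follows_append, h₁, ih, h₂]
    simp only [Follows, and_true]
    constructor
    · rintro ⟨h, h', h''⟩
      exact ⟨⟨by linarith, by linarith⟩, h⟩
    · rintro ⟨⟨h', h''⟩, h⟩
      exact ⟨h, by linarith, by linarith⟩

/-- Each edge imposes a translated half-open interval, and the conditions intersect. The endpoints
are built from heights by sums, differences, maxima and minima, so integrality passes to them. The
empty list imposes nothing and has to be excluded. -/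
theorem exists_setOf_follows_eq_Ico {l : List E} (hl : l ≠ []) :
    ∃ lo hi, {y | Follows a b F y l} = Set.Ico lo hi ∧
      ((∀ e, ∃ n : ℤ, a e = n) → (∀ e, ∃ n : ℤ, b e = n) → (∀ e, ∃ n : ℤ, F e = n) →
        (∃ n : ℤ, lo = n) ∧ ∃ n : ℤ, hi = n) := by
  induction l with
  | nil => exact (hl rfl).elim
  | cons e l ih =>
    by_cases hl' : l = []
    · subst hl'
      refine ⟨b e, b e + F e, by ext; simp [Follows], fun ha hb hF => ⟨hb e, ?_⟩⟩
      obtain ⟨m, hm⟩ := hb e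
      obtain ⟨n, hn⟩ := hF e
      exact ⟨m + n, by simp [hm, hn]⟩
    · obtain ⟨lo, hi, h, hint⟩ := ih hl'
      refine ⟨max (b e) (lo + b e - a e), min (b e + F e) (hi + b e - a e), ?_, ?_⟩
      · ext y
        have := Set.ext_iff.1 h (y - b e + a e)
        simp only [Set.mem_ofPred_eq, Set.mem_Ico] at this
        simp only [Set.mem_ofPred_eq, Follows, this, Set.mem_Ico, max_le_iff, lt_min_iff]
        constructor
        · rintro ⟨⟨h₁, h₂⟩, h₃, h₄⟩
          exact ⟨⟨h₁, by linarith⟩, h₂, by linarith⟩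
        · rintro ⟨⟨h₁, h₃⟩, h₂, h₄⟩
          exact ⟨⟨h₁, h₂⟩, by linarith, by linarith⟩
      · intro ha hb hF
        obtain ⟨⟨i, hi⟩, j, hj⟩ := hint ha hb hF
        obtain ⟨k, hk⟩ := ha e
        obtain ⟨m, hm⟩ := hb e
        obtain ⟨n, hn⟩ := hF e
        exact ⟨⟨max m (i + m - k), by simp [hm, hi, hk]⟩,
          ⟨min (m + n) (j + m - k), by simp [hm, hn, hj, hk]⟩⟩

/-- The amount of flow that follows the edges of the list. -/
noncomputable def followWeight (a b F : E → ℝ) (l : List E) : ℝ :=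
  MeasureTheory.volume.real {y | Follows a b F y l}

theorem measurableSet_follows (l : List E) : MeasurableSet {y | Follows a b F y l} := by
  by_cases hl : l = []
  · simp [hl, Follows]
  · obtain ⟨lo, hi, h, -⟩ := exists_setOf_follows_eq_Ico (a := a) (b := b) (F := F) hl
    rw [h]
    exact measurableSet_Ico

theorem volume_follows_ne_top {l : List E} (hl : l ≠ []) :
    MeasureTheory.volume {y | Follows a b F y l} ≠ ⊤ := by
  obtain ⟨lo, hi, h, -⟩ := exists_setOf_follows_eq_Ico (a := a) (b := b) (F := F) hl
  rw [h, Real.volume_Ico]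
  exact ENNReal.ofReal_ne_top

theorem followWeight_nonneg (l : List E) : 0 ≤ followWeight a b F l :=
  MeasureTheory.measureReal_nonneg

theorem exists_follows_of_followWeight_ne_zero {l : List E} (h : followWeight a b F l ≠ 0) :
    ∃ y, Follows a b F y l := by
  by_contra! hn
  apply h
  have : {y | Follows a b F y l} = ∅ := by
    ext y
    simp [hn y]
  rw [followWeight, this]
  simp

theorem followWeight_integer {l : List E} (hl : l ≠ []) (ha : ∀ e, ∃ n : ℤ, a e = n)
    (hb : ∀ e, ∃ n : ℤ, b e = n) (hF : ∀ e, ∃ n : ℤ, F e = n) :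
    ∃ n : ℤ, followWeight a b F l = n := by
  obtain ⟨lo, hi, h, hint⟩ := exists_setOf_follows_eq_Ico (a := a) (b := b) (F := F) hl
  obtain ⟨⟨i, rfl⟩, j, rfl⟩ := hint ha hb hF
  rw [followWeight, h, Real.volume_real_Ico]
  exact ⟨max (j - i) 0, by simp⟩

end Dynamics

/-! ### Crossings, and the decomposition of a conserved flow by the dynamics -/

namespace MultiDigraph

section Crosses

variable {E : Type*} {r s : E → E → Prop}

/-- `p` enters a common subpath of `p` and `q` by a smaller edge than `q`, but leaves it by a larger
one. -/
def Crosses (r s : E → E → Prop) (p q : List E) : Prop :=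
  ∃ σ f g f' g' p' p'' q' q'', p = p' ++ f :: (σ ++ f' :: p'') ∧ q = q' ++ g :: (σ ++ g' :: q'') ∧
    s f g ∧ r g' f'

/-- The differing edges nearest to `σ` on either side bound the common subpath; `σ` itself may be
empty. -/
theorem crosses_of_lexLT {p₁ p₂ q₁ q₂ : List E} (σ : List E) (h₁ : LexLT s p₁.reverse q₁.reverse)
    (h₂ : LexLT r q₂ p₂) : Crosses r s (p₁ ++ (σ ++ p₂)) (q₁ ++ (σ ++ q₂)) := by
  obtain ⟨τ, f, g, p', q', hp, hq, hfg⟩ := h₁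
  obtain ⟨ρ, g', f', q'', p'', rfl, rfl, hfg'⟩ := h₂
  rw [List.reverse_eq_iff] at hp hq
  subst hp hq
  exact ⟨τ.reverse ++ σ ++ ρ, f, g, f', g', p'.reverse, p'', q'.reverse, q'', by simp, by simp,
    hfg, hfg'⟩

end Crosses

variable {V E : Type*} [Fintype E] {G : MultiDigraph V E} {r s : E → E → Prop} {F : E → ℝ}

open Classical in
/-- Flow conservation at the inner vertices. -/
def IsConserved (G : MultiDigraph V E) (F : E → ℝ) : Prop :=
  ∀ v, ¬ G.IsSource v → ¬ G.IsSink v → ∑ e with G.head e = v, F e = ∑ e with G.tail e = v, F e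

theorem IsConserved.reverse (h : G.IsConserved F) : G.reverse.IsConserved F :=
  fun v h₁ h₂ => (h v h₂ h₁).symm

/-- A point that reaches an inner vertex is below the total inflow, which equals the total outflow,
so some outgoing edge occupies its height. Induction from the sinks completes the path. -/
theorem exists_follows [Finite V] (hG : G.IsDAG) (hr : IsFiberOrder G.tail r)
    (hs : IsFiberOrder G.head s) (hF : ∀ e, 0 ≤ F e) (hc : G.IsConserved F) (e : E) {y : ℝ}
    (hy : offset r F e ≤ y ∧ y < offset r F e + F e) :
    ∃ l v, G.IsPath (G.tail e) (e :: l) v ∧ G.IsSink v ∧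
      Follows (offset s F) (offset r F) F y (e :: l) := by
  classical
  suffices ∀ v, ∀ e, G.tail e = v → ∀ y, (offset r F e ≤ y ∧ y < offset r F e + F e) →
      ∃ l w, G.IsPath (G.tail e) (e :: l) w ∧ G.IsSink w ∧
      Follows (offset s F) (offset r F) F y (e :: l) from this _ e rfl y hy
  intro v
  induction v using hG.induction with
  | h v ih =>
    intro e he y hy
    by_cases hsink : G.IsSink (G.head e)
    · exact ⟨[], G.head e, ⟨rfl, rfl⟩, hsink, hy, trivial⟩
    · have h₁ := hs.offset_add_le_sum hF e
      rw [hc (G.head e) (fun h => h e rfl) hsink] at h₁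
      have h₀ := IsFiberOrder.offset_nonneg (r := s) hF e
      obtain ⟨f, hf, hfy⟩ := hr.exists_mem_Ico (v := G.head e) (y := y - offset r F e + offset s F e)
        (by linarith) (by linarith)
      obtain ⟨l, w, hl, hw, hfol⟩ := ih e he f hf _ hfy
      exact ⟨f :: l, w, ⟨rfl, hf ▸ hl⟩, hw, hy, hfol⟩

/-- Intervals of distinct outgoing edges are disjoint, so the height dictates each edge; ending at
sinks prevents one list from being a proper prefix of the other. -/
theorem follows_unique (hr : IsFiberOrder G.tail r) (hF : ∀ e, 0 ≤ F e) {a : E → ℝ}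
    {u v w : V} {l m : List E} (hl : G.IsPath u l v) (hm : G.IsPath u m w) (hv : G.IsSink v)
    (hw : G.IsSink w) {y : ℝ} (hyl : Follows a (offset r F) F y l)
    (hym : Follows a (offset r F) F y m) : l = m := by
  induction l generalizing u m y with
  | nil =>
    cases m with
    | nil => rfl
    | cons f m => exact (hv f (hm.1.trans hl)).elim
  | cons e l ih =>
    cases m with
    | nil => exact (hw e (hl.1.trans hm)).elim
    | cons f m =>
      obtain rfl := hr.eq_of_mem_Ico hF (hl.1.trans hm.1.symm) hyl.1 hym.1
      rw [ih hl.2 hm.2 hyl.2 hym.2]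

/-- Lists of edges that carry flow do not cross. -/
theorem not_crosses_of_follows (hr : IsFiberOrder G.tail r) (hs : IsFiberOrder G.head s)
    (hF : ∀ e, 0 ≤ F e) {p q : List E} {y z : ℝ} (hp : Follows (offset s F) (offset r F) F y p)
    (hq : Follows (offset s F) (offset r F) F z q) : ¬ Crosses r s p q := by
  rintro ⟨σ, f, g, f', g', p', p'', q', q'', rfl, rfl, hfg, hgf⟩
  rw [follows_append, Follows, follows_append, Follows] at hp hq
  -- On entering `σ` the point of `p` is below that of `q`, on leaving it is above. But both undergo
  -- the same drift along `σ`.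
  have h₁ := hs.offset_add_le hF hfg
  have h₂ := hr.offset_add_le hF hgf
  obtain ⟨-, ⟨hp₁, hp₂⟩, -, ⟨hp₃, hp₄⟩, -⟩ := hp
  obtain ⟨-, ⟨hq₁, hq₂⟩, -, ⟨hq₃, hq₄⟩, -⟩ := hq
  linarith

open Classical in
/-- Every edge is covered exactly by the flow that follows the routes. -/
theorem sum_followWeight [Finite V] [Fintype G.Route] (hG : G.IsDAG) (hr : IsFiberOrder G.tail r)
    (hs : IsFiberOrder G.head s) (hF : ∀ e, 0 ≤ F e) (hc : G.IsConserved F) (e : E) :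
    ∑ p : G.Route with e ∈ p.edges, followWeight (offset s F) (offset r F) F p.edges = F e := by
  set a := offset s F
  set b := offset r F
  have hsplit : ∀ p : G.Route, ∃ l : List E × List E, e ∈ p.edges → p.edges = l.1 ++ e :: l.2 := by
    intro p
    by_cases hp : e ∈ p.edges
    · obtain ⟨l₁, l₂, h⟩ := List.append_of_mem hp
      exact ⟨(l₁, l₂), fun _ => h⟩
    · exact ⟨([], []), fun h => (hp h).elim⟩
  choose l hl using hsplit
  -- Heights are now measured at the tail of `e` instead of at the start of `p`, so that the sets of
  -- all routes through `e` become comparable: they tile the interval of `e`.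
  let J : G.Route → Set ℝ := fun p => (fun y => y - drift a b (l p).1) ⁻¹' {y | Follows a b F y p.edges}
  have hJ : ∀ p : G.Route, e ∈ p.edges → ∀ y, y ∈ J p ↔
      Follows b a F y (l p).1.reverse ∧ Follows a b F y (e :: (l p).2) := by
    intro p hp y
    change Follows a b F _ p.edges ↔ _
    rw [hl p hp, follows_append, ← follows_reverse]
    simp
  have hpath : ∀ p : G.Route, e ∈ p.edges → G.IsPath p.start (l p).1 (G.tail e) ∧
      G.IsPath (G.tail e) (e :: (l p).2) p.finish := by
    intro p hp
    have := p.isPath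
    rw [hl p hp, isPath_append] at this
    obtain ⟨w, h₁, h₂⟩ := this
    obtain rfl := h₂.1
    exact ⟨h₁, h₂⟩
  have hvol : ∀ p, MeasureTheory.volume (J p) = MeasureTheory.volume {y | Follows a b F y p.edges} :=
    fun p => by
    simp only [J, sub_eq_add_neg]
    exact MeasureTheory.measure_preimage_add_right _ _ _
  have hvol' : ∀ p, followWeight a b F p.edges = MeasureTheory.volume.real (J p) := fun p => by
    rw [followWeight, MeasureTheory.measureReal_def, MeasureTheory.measureReal_def, hvol]
  simp only [hvol']
  have hfin : ∀ p ∈ Finset.univ.filter fun p : G.Route => e ∈ p.edges,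
      MeasureTheory.volume (J p) ≠ ⊤ := by
    intro p hp
    rw [hvol]
    exact volume_follows_ne_top (List.ne_nil_of_mem (by simpa using hp))
  rw [← MeasureTheory.measureReal_biUnion_finset (h := hfin)]
  · have : ⋃ p ∈ (Finset.univ.filter fun p : G.Route => e ∈ p.edges), J p
        = Set.Ico (b e) (b e + F e) := by
      ext y
      simp only [Finset.mem_filter, Finset.mem_univ, true_and, Set.mem_iUnion, exists_prop,
        Set.mem_Ico]
      constructor
      · rintro ⟨p, hp, hy⟩
        exact ((hJ p hp y).1 hy).2.1
      · intro hy
        obtain ⟨l₂, w, h₂, hw, hf₂⟩ := exists_follows hG hr hs hF hc e hy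
        -- The past of the point is its future in the reversed graph, starting at the height that it
        -- has at the head of `e`.
        obtain ⟨l₁, u, h₁, hu, hf₁⟩ := exists_follows (G := G.reverse) hG.reverse hs hr hF
          hc.reverse e (y := y - b e + a e) ⟨by linarith, by linarith⟩
        have h₁' := h₁.2.reverse
        rw [show G.reverse.reverse = G from rfl] at h₁'
        let p : G.Route := ⟨u, w, l₁.reverse ++ e :: l₂, isPath_append.2 ⟨_, h₁', h₂⟩, hu, hw⟩
        have hp : e ∈ p.edges := by simp [p]
        have hpl := hl p hp
        have h₃ := hG.split_unique (l₁ := l₁.reverse) (l₂ := e :: l₂) (l₁' := (l p).1)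
          (l₂' := e :: (l p).2) hpl h₁' (hpath p hp).1 h₂ (hpath p hp).2
        refine ⟨p, hp, (hJ p hp y).2 ⟨?_, h₃.2 ▸ hf₂⟩⟩
        rw [← h₃.1, List.reverse_reverse]
        have h₄ := hf₁.2
        rwa [show y - b e + a e - offset s F e + offset r F e = y by simp [a, b]] at h₄
    rw [this, Real.volume_real_Ico]
    simp [hF e]
  · intro p hp q hq hpq
    simp only [Finset.coe_filter, Finset.mem_univ, true_and, Set.mem_ofPred_eq] at hp hq
    refine Set.disjoint_left.2 fun y hy hy' => hpq ?_
    rw [hJ p hp] at hy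
    rw [hJ q hq] at hy'
    have h₁ := follows_unique hr hF (hpath p hp).2 (hpath q hq).2 p.isSink_finish q.isSink_finish
      hy.2 hy'.2
    have h₂ := follows_unique (G := G.reverse) hs hF (hpath p hp).1.reverse (hpath q hq).1.reverse
      p.isSource_start q.isSource_start hy.1 hy'.1
    refine Route.ext_edges (List.ne_nil_of_mem hp) ?_
    rw [hl p hp, hl q hq, h₁, List.reverse_injective h₂]
  · intro p _
    exact (measurableSet_follows p.edges).preimage (measurable_id.sub_const _)

end MultiDigraph

/-! ### Uniqueness of noncrossing decompositions of flows -/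

namespace MultiDigraph

variable {V E : Type*} {G : MultiDigraph V E} {r s : E → E → Prop}

theorem IsDAG.eq_of_tail_eq (hG : G.IsDAG) {u v : V} {l : List E} (h : G.IsPath u l v) {e f : E}
    (he : e ∈ l) (hf : f ∈ l) (hef : G.tail e = G.tail f) : e = f := by
  obtain ⟨l₁, l₂, hl⟩ := List.append_of_mem he
  obtain ⟨m₁, m₂, hm⟩ := List.append_of_mem hf
  have h₁ := h
  rw [hl, isPath_append] at h₁
  obtain ⟨w, h₁, h₂⟩ := h₁
  have h₃ := h
  rw [hm, isPath_append] at h₃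
  obtain ⟨w', h₃, h₄⟩ := h₃
  obtain rfl := h₂.1
  obtain rfl := h₄.1
  have := (hG.split_unique (hl.symm.trans hm) h₁ (hef ▸ h₃) h₂ (hef.symm ▸ h₄)).2
  exact (List.cons.inj this).1

theorem IsDAG.eq_of_head_eq (hG : G.IsDAG) {u v : V} {l : List E} (h : G.IsPath u l v) {e f : E}
    (he : e ∈ l) (hf : f ∈ l) (hef : G.head e = G.head f) : e = f :=
  hG.reverse.eq_of_tail_eq h.reverse (List.mem_reverse.2 he) (List.mem_reverse.2 hf) hef

theorem Route.exists_cons_of_append {p : G.Route} {l₁ l₂ : List E} {e : E}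
    (hp : p.edges = l₁ ++ e :: l₂) (h : ¬ G.IsSink (G.head e)) :
    ∃ f l, l₂ = f :: l ∧ G.tail f = G.head e := by
  have := p.isPath
  rw [hp, isPath_append] at this
  obtain ⟨w, -, h₂⟩ := this
  cases l₂ with
  | nil => exact (h (h₂.2 ▸ p.isSink_finish)).elim
  | cons f l => exact ⟨f, l, rfl, h₂.2.1⟩

theorem Route.exists_concat_of_append {p : G.Route} {l₁ l₂ : List E} {e : E}
    (hp : p.edges = l₁ ++ e :: l₂) (h : ¬ G.IsSource (G.tail e)) :
    ∃ f l, l₁ = l ++ [f] ∧ G.head f = G.tail e := by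
  obtain ⟨f, l, hl, hf⟩ := p.reverse.exists_cons_of_append (l₁ := l₂.reverse) (l₂ := l₁.reverse)
    (e := e) (by simp [Route.reverse, hp]) h
  exact ⟨f, l.reverse, by simpa using congrArg List.reverse hl, hf⟩

theorem Route.split_unique (hG : G.IsDAG) {p : G.Route} {l₁ l₂ m₁ m₂ : List E} {e : E}
    (hl : p.edges = l₁ ++ e :: l₂) (hm : p.edges = m₁ ++ e :: m₂) : l₁ = m₁ ∧ l₂ = m₂ := by
  have h₁ := p.isPath
  rw [hl, isPath_append] at h₁
  obtain ⟨w, h₁, h₂⟩ := h₁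
  have h₃ := p.isPath
  rw [hm, isPath_append] at h₃
  obtain ⟨w', h₃, h₄⟩ := h₃
  obtain rfl := h₂.1
  obtain rfl := h₄.1
  have := hG.split_unique (hl.symm.trans hm) h₁ h₃ h₂ h₄
  exact ⟨this.1, (List.cons.inj this.2).2⟩

/-- The route `q` uses the edge `e`, and there it comes before a route that follows `p₁` before `e`
and `p₂` after `e`. -/
def Before (r s : E → E → Prop) (p₁ : List E) (e : E) (p₂ : List E) (q : G.Route) : Prop :=
  ∃ q₁ q₂, q.edges = q₁ ++ e :: q₂ ∧ (LexLT s q₁.reverse p₁.reverse ∨ LexLT r q₂ p₂)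

/-- For routes that do not cross, the order at a vertex can be read off from the edges before the
vertex or from the edges after it. -/
theorem before_iff (hr : IsFiberOrder G.tail r) (hs : IsFiberOrder G.head s) {p q : G.Route}
    {p₁ p₂ : List E} {e f : E} (hp : p.edges = p₁ ++ e :: f :: p₂) (hef : G.tail f = G.head e)
    (hpq : ¬ Crosses r s p.edges q.edges) (hqp : ¬ Crosses r s q.edges p.edges) :
    ((∃ g ∈ q.edges, s g e) ∨ Before r s p₁ e (f :: p₂) q) ↔
      ((∃ g ∈ q.edges, r g f) ∨ Before r s (p₁ ++ [e]) f p₂ q) := by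
  have hsink : ¬ G.IsSink (G.head e) := fun h => h f hef
  have hsource : ¬ G.IsSource (G.tail f) := fun h => h e hef.symm
  rw [hp] at hpq hqp
  constructor
  -- A route that comes first at the arrival must not come later at the departure, since that would
  -- be a crossing. Leaving by the same edge `f` keeps the earlier difference as the witness. The
  -- converse is the mirror image.
  · rintro (⟨g, hg, hge⟩ | ⟨q₁, q₂, hq, h⟩)
    · obtain ⟨q₁, q₂, hq⟩ := List.append_of_mem hg
      have hgh := hs.eq_of_lt _ _ hge
      obtain ⟨h, q₃, rfl, hh⟩ := q.exists_cons_of_append hq (hgh ▸ hsink)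
      have hlex : LexLT s (q₁ ++ [g]).reverse (p₁ ++ [e]).reverse := by
        simpa using LexLT.cons_iff.2 (Or.inl hge)
      rcases hr.total h f (by rw [hh, hef, hgh]) with rfl | hhf | hhf
      · exact Or.inr ⟨q₁ ++ [g], q₃, by simp [hq], Or.inl hlex⟩
      · exact Or.inl ⟨h, by simp [hq], hhf⟩
      · have := crosses_of_lexLT (p₂ := h :: q₃) (q₂ := f :: p₂) [] hlex
          (LexLT.cons_iff.2 (Or.inl hhf))
        exact (hqp (by simpa [hq] using this)).elim
    · obtain ⟨h, q₃, rfl, hh⟩ := q.exists_cons_of_append hq hsink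
      rcases h with hlex | hlex
      · rcases hr.total h f (by rw [hh, hef]) with rfl | hhf | hhf
        · refine Or.inr ⟨q₁ ++ [e], q₃, by simp [hq], Or.inl ?_⟩
          simpa using LexLT.append_left [e] hlex
        · exact Or.inl ⟨h, by simp [hq], hhf⟩
        · have := crosses_of_lexLT (p₂ := h :: q₃) (q₂ := f :: p₂) [e] hlex
            (LexLT.cons_iff.2 (Or.inl hhf))
          exact (hqp (by simpa [hq] using this)).elim
      · rcases LexLT.cons_iff.1 hlex with hhf | ⟨rfl, hlex'⟩
        · exact Or.inl ⟨h, by simp [hq], hhf⟩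
        · exact Or.inr ⟨q₁ ++ [e], q₃, by simp [hq], Or.inr hlex'⟩
  · rintro (⟨h, hh, hhf⟩ | ⟨q₁, q₂, hq, h⟩)
    · obtain ⟨q₁, q₂, hq⟩ := List.append_of_mem hh
      have hht := hr.eq_of_lt _ _ hhf
      obtain ⟨g, q₀, rfl, hg⟩ := q.exists_concat_of_append hq (hht ▸ hsource)
      have hlex : LexLT r (h :: q₂) (f :: p₂) := LexLT.cons_iff.2 (Or.inl hhf)
      rcases hs.total g e (by rw [hg, ← hef, hht]) with rfl | hge | hge
      · exact Or.inr ⟨q₀, h :: q₂, by simp [hq], Or.inr hlex⟩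
      · exact Or.inl ⟨g, by simp [hq], hge⟩
      · have := crosses_of_lexLT (p₁ := p₁ ++ [e]) (q₁ := q₀ ++ [g]) (r := r) (s := s) [] (by
          simpa using LexLT.cons_iff.2 (Or.inl hge)) hlex
        exact (hpq (by simpa [hq] using this)).elim
    · obtain ⟨g, q₀, rfl, hg⟩ := q.exists_concat_of_append hq hsource
      rcases h with hlex | hlex
      · simp only [List.reverse_append, List.reverse_cons, List.reverse_nil, List.nil_append,
          List.singleton_append] at hlex
        rcases LexLT.cons_iff.1 hlex with hge | ⟨rfl, hlex'⟩
        · exact Or.inl ⟨g, by simp [hq], hge⟩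
        · exact Or.inr ⟨q₀, f :: q₂, by simp [hq], Or.inl hlex'⟩
      · rcases hs.total g e (by rw [hg, ← hef]) with rfl | hge | hge
        · exact Or.inr ⟨q₀, f :: q₂, by simp [hq], Or.inr (hlex.append_left [f])⟩
        · exact Or.inl ⟨g, by simp [hq], hge⟩
        · have := crosses_of_lexLT (p₁ := p₁ ++ [e]) (q₁ := q₀ ++ [g]) (r := r) (s := s) [f] (by
            simpa using LexLT.cons_iff.2 (Or.inl hge)) hlex
          exact (hpq (by simpa [hq] using this)).elim

variable {F : E → ℝ} [Fintype G.Route] {c : G.Route → ℝ}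

open Classical in
/-- The flow that is the sum of the routes with the given weights. -/
noncomputable def routeFlow (c : G.Route → ℝ) (e : E) : ℝ := ∑ p with e ∈ p.edges, c p

open Classical in
-- A route has at most one edge in each fibre, so summing the flow over the edges below `e` counts
-- no route twice.
theorem offset_eq_sum_route [Fintype E] {t : E → V} {r : E → E → Prop} (hr : IsFiberOrder t r)
    (ht : ∀ q : G.Route, ∀ g ∈ q.edges, ∀ g' ∈ q.edges, t g = t g' → g = g')
    (hsum : ∀ e, routeFlow c e = F e) (e : E) :
    offset r F e = ∑ q with ∃ g ∈ q.edges, r g e, c q := by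
  simp only [offset, ← hsum, routeFlow]
  rw [← Finset.sum_biUnion]
  · congr 1
    ext q
    simp only [Finset.mem_biUnion, Finset.mem_filter, Finset.mem_univ, true_and]
    exact ⟨fun ⟨g, h, h'⟩ => ⟨g, h', h⟩, fun ⟨g, h, h'⟩ => ⟨g, h', h⟩⟩
  · intro g hg g' hg' hne
    simp only [Finset.coe_filter, Finset.mem_univ, true_and, Set.mem_ofPred_eq] at hg hg'
    refine Finset.disjoint_left.2 fun q hq hq' => hne ?_
    simp only [Finset.mem_filter, Finset.mem_univ, true_and] at hq hq'
    exact ht q g hq g' hq' ((hr.eq_of_lt _ _ hg).trans (hr.eq_of_lt _ _ hg').symm)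

open Classical in
/-- The total weight of the routes that come before a given one at the edge `e`. -/
noncomputable def position (r s : E → E → Prop) (c : G.Route → ℝ) (p₁ : List E) (e : E)
    (p₂ : List E) : ℝ :=
  ∑ q with Before r s p₁ e p₂ q, c q

/-- The routes counted by `position` all use `e`, and `p` is not among them, since neither of its
parts precedes itself. -/
theorem position_add_le (hG : G.IsDAG) (hr : IsFiberOrder G.tail r) (hs : IsFiberOrder G.head s)
    (hc : ∀ p, 0 ≤ c p) {p : G.Route} {p₁ p₂ : List E} {e : E} (hp : p.edges = p₁ ++ e :: p₂)
    (hsum : ∀ e, routeFlow c e = F e) :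
    position r s c p₁ e p₂ + c p ≤ F e := by
  classical
  have hnot : p ∉ Finset.univ.filter fun q => Before r s p₁ e p₂ q := by
    simp only [Finset.mem_filter, Finset.mem_univ, true_and]
    rintro ⟨q₁, q₂, hq, h⟩
    obtain ⟨rfl, rfl⟩ := Route.split_unique hG hp hq
    exact h.elim (LexLT.irrefl hs.irrefl _) (LexLT.irrefl hr.irrefl _)
  rw [position, add_comm, ← Finset.sum_insert hnot, ← hsum, routeFlow]
  refine Finset.sum_le_sum_of_subset_of_nonneg (fun q hq => ?_) fun _ _ _ => hc _
  simp only [Finset.mem_insert, Finset.mem_filter, Finset.mem_univ, true_and] at hq ⊢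
  rcases hq with rfl | ⟨q₁, q₂, hq, -⟩
  · simp [hp]
  · simp [hq]

/-- Place `p` in each of its edges on top of the routes that come before it. Both sides are the
resulting height at the vertex between `e` and `f`, counted on arrival and on departure; by
`before_iff` the same routes lie below `p` in the two counts. So this placement moves with the
dynamics. -/
theorem offset_add_position [Fintype E] (hG : G.IsDAG) (hr : IsFiberOrder G.tail r)
    (hs : IsFiberOrder G.head s) (hcross : ∀ p q, c p ≠ 0 → c q ≠ 0 → ¬ Crosses r s p.edges q.edges)
    (hsum : ∀ e, routeFlow c e = F e) {p : G.Route} (hp0 : c p ≠ 0)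
    {p₁ p₂ : List E} {e f : E} (hp : p.edges = p₁ ++ e :: f :: p₂) :
    offset s F e + position r s c p₁ e (f :: p₂) =
      offset r F f + position r s c (p₁ ++ [e]) f p₂ := by
  classical
  have hef : G.tail f = G.head e := by
    have := p.isPath
    rw [hp, isPath_append] at this
    obtain ⟨w, -, h⟩ := this
    exact h.2.1
  rw [offset_eq_sum_route hs (fun q g hg g' hg' => hG.eq_of_head_eq q.isPath hg hg') hsum,
    offset_eq_sum_route hr (fun q g hg g' hg' => hG.eq_of_tail_eq q.isPath hg hg') hsum,
    position, position, ← Finset.sum_union, ← Finset.sum_union, ← Finset.filter_or,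
    ← Finset.filter_or, Finset.sum_filter, Finset.sum_filter]
  · refine Finset.sum_congr rfl fun q _ => ?_
    by_cases hq : c q = 0
    · simp [hq]
    · rw [if_congr (before_iff hr hs hp hef (hcross p q hp0 hq) (hcross q p hq hp0)) rfl rfl]
  · refine Finset.disjoint_left.2 fun q hq hq' => ?_
    simp only [Finset.mem_filter, Finset.mem_univ, true_and] at hq hq'
    obtain ⟨g, hg, hgf⟩ := hq
    obtain ⟨q₁, q₂, hq, -⟩ := hq'
    have := hG.eq_of_tail_eq q.isPath hg (by simp [hq]) (hr.eq_of_lt _ _ hgf)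
    exact hr.irrefl _ (this ▸ hgf)
  · refine Finset.disjoint_left.2 fun q hq hq' => ?_
    simp only [Finset.mem_filter, Finset.mem_univ, true_and] at hq hq'
    obtain ⟨g, hg, hge⟩ := hq
    obtain ⟨q₁, q₂, hq, -⟩ := hq'
    have := hG.eq_of_head_eq q.isPath hg (by simp [hq]) (hs.eq_of_lt _ _ hge)
    exact hs.irrefl _ (this ▸ hge)

/-- The slot of length `c p` assigned to `p` stays inside every edge by `position_add_le`, and
`offset_add_position` identifies consecutive slots, so all its points follow `p`. -/
theorem follows_of_position [Fintype E] (hG : G.IsDAG) (hr : IsFiberOrder G.tail r)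
    (hs : IsFiberOrder G.head s) (hc : ∀ p, 0 ≤ c p)
    (hcross : ∀ p q, c p ≠ 0 → c q ≠ 0 → ¬ Crosses r s p.edges q.edges)
    (hsum : ∀ e, routeFlow c e = F e) {p : G.Route} (hp0 : c p ≠ 0)
    {p₁ p₂ : List E} {e : E} (hp : p.edges = p₁ ++ e :: p₂) {z : ℝ}
    (hz : position r s c p₁ e p₂ ≤ z) (hz' : z < position r s c p₁ e p₂ + c p) :
    Follows (offset s F) (offset r F) F (offset r F e + z) (e :: p₂) := by
  have h₁ := position_add_le hG hr hs hc hp hsum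
  have h₀ : 0 ≤ position r s c p₁ e p₂ := Finset.sum_nonneg fun _ _ => hc _
  refine ⟨⟨by linarith, by linarith⟩, ?_⟩
  induction p₂ generalizing p₁ e z with
  | nil => trivial
  | cons f p₂ ih =>
    have h₂ := offset_add_position hG hr hs hcross hsum hp0 hp
    have hp' : p.edges = (p₁ ++ [e]) ++ f :: p₂ := by simp [hp]
    have h₃ := position_add_le hG hr hs hc hp' hsum
    have h₄ : 0 ≤ position r s c (p₁ ++ [e]) f p₂ := Finset.sum_nonneg fun _ _ => hc _
    refine ⟨⟨by linarith, by linarith⟩, ?_⟩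
    have := ih hp' (z := z + offset s F e - offset r F f) (by linarith) (by linarith) h₃ h₄
    convert this using 1
    ring

/-- A noncrossing decomposition of a flow into routes is the one given by the dynamics. -/
theorem eq_followWeight [Finite V] [Fintype E] (hG : G.IsDAG) (hr : IsFiberOrder G.tail r)
    (hs : IsFiberOrder G.head s) (hF : G.IsConserved F) (hc : ∀ p, 0 ≤ c p)
    (hcross : ∀ p q, c p ≠ 0 → c q ≠ 0 → ¬ Crosses r s p.edges q.edges)
    (hsum : ∀ e, routeFlow c e = F e) {p : G.Route}
    (hp : p.edges ≠ []) : c p = followWeight (offset s F) (offset r F) F p.edges := by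
  classical
  have hF0 : ∀ e, 0 ≤ F e := fun e => hsum e ▸ Finset.sum_nonneg fun _ _ => hc _
  obtain ⟨e, l, hl⟩ := List.exists_cons_of_ne_nil hp
  -- A whole interval of length `c q` follows `q`, which gives an inequality for every route through
  -- the first edge `e` of `p`. Both families of weights sum to `F e`, so equality holds termwise.
  have hle : ∀ q ∈ Finset.univ.filter fun q : G.Route => e ∈ q.edges,
      c q ≤ followWeight (offset s F) (offset r F) F q.edges := by
    intro q hq
    have hq0 : q.edges ≠ [] := List.ne_nil_of_mem (by simpa using hq)
    by_cases hcq : c q = 0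
    · rw [hcq]
      exact followWeight_nonneg _
    · obtain ⟨f, m, hm⟩ := List.exists_cons_of_ne_nil hq0
      have hsub : Set.Ico (offset r F f + position r s c [] f m)
          (offset r F f + position r s c [] f m + c q) ⊆
          {y | Follows (offset s F) (offset r F) F y q.edges} := by
        intro y hy
        have := follows_of_position hG hr hs hc hcross hsum hcq (p₁ := []) (p₂ := m) (e := f) hm
          (z := y - offset r F f) (by linarith [hy.1]) (by linarith [hy.2])
        rw [add_sub_cancel] at this
        rwa [Set.mem_ofPred_eq, hm]
      have := MeasureTheory.measureReal_mono hsub (volume_follows_ne_top hq0)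
      rw [Real.volume_real_Ico] at this
      simpa [hc q, followWeight] using this
  have hsum' := sum_followWeight hG hr hs hF0 hF e
  rw [← hsum e, routeFlow] at hsum'
  exact (Finset.sum_eq_sum_iff_of_le hle).1 hsum'.symm p (by simp [hl])

end MultiDigraph

/-! ### The augmented graph and its layerings -/

namespace Augmentation

open MultiDigraph

variable {V E VX VY EX EY : Type*} [Fintype EX] [Fintype EY]
  {G : MultiDigraph V E} {a : V → ℤ} {A : Augmentation G a VX VY EX EY}

theorem isSource_inflow (s : VX) : A.graph.IsSource (.inr (.inl s)) := by
  rintro (e | x | y) <;> simp [graph]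

theorem isSink_outflow (y : VY) : A.graph.IsSink (.inr (.inr y)) := by
  rintro (e | x | y) <;> simp [graph]

theorem not_isSink_inflow (s : VX) : ¬ A.graph.IsSink (.inr (.inl s)) := by
  intro h
  obtain ⟨x, hx, -⟩ := A.existsUnique_x s
  exact h (.inr (.inl x)) (by simp [graph, hx])

theorem not_isSource_outflow (y : VY) : ¬ A.graph.IsSource (.inr (.inr y)) := by
  intro h
  obtain ⟨x, hx, -⟩ := A.existsUnique_y y
  exact h (.inr (.inr x)) (by simp [graph, hx])

/-- Inflow edges start outside `V` and outflow edges lead to sinks, so neither can occur between two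
vertices of `V`. Acyclicity therefore passes to the augmented graph. -/
theorem exists_isPath_of_graph {u w : V} {l : List (E ⊕ EX ⊕ EY)}
    (h : A.graph.IsPath (.inl u) l (.inl w)) : ∃ m, l = m.map Sum.inl ∧ G.IsPath u m w := by
  induction l generalizing u with
  | nil => exact ⟨[], rfl, Sum.inl_injective h⟩
  | cons e l ih =>
    rcases e with e | x | y
    · obtain ⟨m, rfl, hm⟩ := ih h.2
      exact ⟨e :: m, rfl, Sum.inl_injective h.1, hm⟩
    · simp [IsPath, graph] at h
    · cases l with
      | nil => simp [IsPath, graph] at h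
      | cons f l => exact (isSink_outflow _ f h.2.1).elim

theorem isDAG_graph (hG : G.IsDAG) : A.graph.IsDAG := by
  intro v l h
  rcases v with v | s | y
  · obtain ⟨m, rfl, hm⟩ := exists_isPath_of_graph h
    simp [hG v m hm]
  · have := h.reverse
    cases hl : l.reverse with
    | nil => simpa using hl
    | cons e l' =>
      rw [hl] at this
      exact (isSource_inflow s e this.1).elim
  · cases l with
    | nil => rfl
    | cons e l => exact (isSink_outflow y e h.1).elim

/-! ### Framings as fibre orders -/

namespace Framing

variable (F : A.Framing)

theorem isFiberOrder_outLT : IsFiberOrder A.graph.tail F.OutLT where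
  eq_of_lt := by
    rintro e f ⟨i, he, hf, -⟩
    rw [he, hf]
  irrefl := by
    rintro e ⟨i, he, _, h⟩
    let _ := F.out i
    exact lt_irrefl _ h
  trans := by
    rintro e f g ⟨i, he, hf, h⟩ ⟨j, hf', hg, h'⟩
    obtain rfl := Sum.inl_injective (hf.symm.trans hf')
    let _ := F.out i
    exact ⟨i, he, hg, lt_trans h h'⟩
  total := by
    intro e f hef
    rcases he : A.graph.tail e with i | s | y
    · have hf := hef.symm.trans he
      let _ := F.out i
      rcases lt_trichotomy (⟨e, he⟩ : {e // A.graph.tail e = .inl i}) ⟨f, hf⟩ with h | h | h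
      · exact Or.inr (Or.inl ⟨i, he, hf, h⟩)
      · exact Or.inl (congrArg Subtype.val h)
      · exact Or.inr (Or.inr ⟨i, hf, he, h⟩)
    -- A framing has no order at an inflow vertex, and needs none: only one edge leaves it.
    · have hf := hef.symm.trans he
      rcases e with e | x | y <;> rcases f with f | x' | y' <;> simp [graph] at he hf
      left
      rw [(A.existsUnique_x s).unique he hf]
    · exact (isSink_outflow y e he).elim

theorem isFiberOrder_incLT : IsFiberOrder A.graph.head F.IncLT where
  eq_of_lt := by
    rintro e f ⟨i, he, hf, -⟩
    rw [he, hf]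
  irrefl := by
    rintro e ⟨i, he, _, h⟩
    let _ := F.inc i
    exact lt_irrefl _ h
  trans := by
    rintro e f g ⟨i, he, hf, h⟩ ⟨j, hf', hg, h'⟩
    obtain rfl := Sum.inl_injective (hf.symm.trans hf')
    let _ := F.inc i
    exact ⟨i, he, hg, lt_trans h h'⟩
  total := by
    intro e f hef
    rcases he : A.graph.head e with i | s | y
    · have hf := hef.symm.trans he
      let _ := F.inc i
      rcases lt_trichotomy (⟨e, he⟩ : {e // A.graph.head e = .inl i}) ⟨f, hf⟩ with h | h | h
      · exact Or.inr (Or.inl ⟨i, he, hf, h⟩)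
      · exact Or.inl (congrArg Subtype.val h)
      · exact Or.inr (Or.inr ⟨i, hf, he, h⟩)
    · exact (isSource_inflow s e he).elim
    · have hf := hef.symm.trans he
      rcases e with e | x | y' <;> rcases f with f | x' | y'' <;> simp [graph] at he hf
      left
      rw [(A.existsUnique_y y).unique he hf]

variable {F}

theorem preLT_iff {p q : List (E ⊕ EX ⊕ EY)} :
    F.PreLT p q ↔ LexLT F.IncLT p.reverse q.reverse := by
  constructor
  · rintro ⟨σ, f, g, p', q', rfl, rfl, h⟩
    exact ⟨σ.reverse, f, g, p'.reverse, q'.reverse, by simp, by simp, h⟩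
  · rintro ⟨σ, f, g, p', q', hp, hq, h⟩
    rw [List.reverse_eq_iff] at hp hq
    exact ⟨σ.reverse, f, g, p'.reverse, q'.reverse, by simp [hp], by simp [hq], h⟩

/-- The common vertex of a crossing may be moved along the common subpath; in the converse direction
its first vertex, the head of `f` and of `g`, is used. -/
theorem cross_iff {p q : A.graph.Route} :
    F.Cross p q ↔ Crosses F.OutLT F.IncLT p.edges q.edges := by
  constructor
  · rintro ⟨i, p₁, p₂, q₁, q₂, hp, hq, h₁, h₂⟩
    rw [hp.1, hq.1]
    exact crosses_of_lexLT [] (preLT_iff.1 h₁) h₂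
  · rintro ⟨σ, f, g, f', g', p', p'', q', q'', hp, hq, hfg, hgf⟩
    have hp₁ : p.edges = (p' ++ [f]) ++ (σ ++ f' :: p'') := by simp [hp]
    have hq₁ : q.edges = (q' ++ [g]) ++ (σ ++ g' :: q'') := by simp [hq]
    have hfin : ∀ {u w : V ⊕ VX ⊕ VY} {l e}, A.graph.IsPath u (l ++ [e]) w → w = A.graph.head e := by
      intro u w l e h
      obtain ⟨x, -, h⟩ := isPath_append.1 h
      exact h.2.symm
    have hp₂ := p.isPath
    have hq₂ := q.isPath
    rw [hp₁, isPath_append] at hp₂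
    rw [hq₁, isPath_append] at hq₂
    obtain ⟨w, hw₁, hw₂⟩ := hp₂
    obtain ⟨w', hw₃, hw₄⟩ := hq₂
    obtain rfl := hfin hw₁
    obtain rfl := hfin hw₃
    have hh := F.isFiberOrder_incLT.eq_of_lt _ _ hfg
    rw [← hh] at hw₃ hw₄
    exact ⟨_, _, _, _, _, ⟨hp₁, hw₁, hw₂⟩, ⟨hq₁, hw₃, hw₄⟩,
      ⟨[], f, g, p', q', rfl, rfl, hfg⟩, ⟨σ, g', f', q'', p'', rfl, rfl, hgf⟩⟩

theorem postLT_irrefl (p : List (E ⊕ EX ⊕ EY)) : ¬ F.PostLT p p :=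
  LexLT.irrefl F.isFiberOrder_outLT.irrefl p

theorem postLT_trans {p q s : List (E ⊕ EX ⊕ EY)} (h : F.PostLT p q) (h' : F.PostLT q s) :
    F.PostLT p s :=
  LexLT.trans F.isFiberOrder_outLT.trans h h'

/-- As both paths end at sinks, neither is a proper prefix of the other, so distinct paths diverge
at some edge. -/
theorem postLT_total {u v w : V ⊕ VX ⊕ VY} {p q : List (E ⊕ EX ⊕ EY)} (hp : A.graph.IsPath u p v)
    (hq : A.graph.IsPath u q w) (hv : A.graph.IsSink v) (hw : A.graph.IsSink w) :
    p = q ∨ F.PostLT p q ∨ F.PostLT q p := by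
  induction p generalizing u q with
  | nil =>
    cases q with
    | nil => exact Or.inl rfl
    | cons f q => exact (hv f (hq.1.trans hp)).elim
  | cons e p ih =>
    cases q with
    | nil => exact (hw e (hp.1.trans hq)).elim
    | cons f q =>
      rcases F.isFiberOrder_outLT.total e f (hp.1.trans hq.1.symm) with rfl | h | h
      · rcases ih hp.2 hq.2 with rfl | h | h
        · exact Or.inl rfl
        · exact Or.inr (Or.inl (LexLT.cons_iff.2 (Or.inr ⟨rfl, h⟩)))
        · exact Or.inr (Or.inr (LexLT.cons_iff.2 (Or.inr ⟨rfl, h⟩)))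
      · exact Or.inr (Or.inl (LexLT.cons_iff.2 (Or.inl h)))
      · exact Or.inr (Or.inr (LexLT.cons_iff.2 (Or.inl h)))

end Framing

/-- A route from an inflow vertex to an outflow vertex. -/
def IsThrough (p : A.graph.Route) : Prop :=
  (∃ s, p.start = .inr (.inl s)) ∧ ∃ y, p.finish = .inr (.inr y)

theorem IsThrough.edges_ne_nil {p : A.graph.Route} (hp : IsThrough p) : p.edges ≠ [] := by
  intro h
  obtain ⟨⟨s, hs⟩, y, hy⟩ := hp
  have := p.isPath
  rw [h, hs, hy] at this
  simp [IsPath] at this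

/-! ### Elementary properties of layerings -/

namespace IsLayering

variable {L M : Finset A.graph.Route}

/-- Sources and sinks in `V` have netflow `0`, so no route of a layering starts or ends there. -/
theorem isThrough (hL : A.IsLayering L) {p : A.graph.Route} (hp : p ∈ L) : IsThrough p := by
  classical
  constructor
  · have h := hL.1 p.start p.isSource_start
    have hpos : 0 < (L.filter fun q => q.start = p.start).card :=
      Finset.card_pos.2 ⟨p, by simp [hp]⟩
    rcases hs : p.start with v | s | y
    · rw [hs] at h hpos
      simp only [netflow] at h
      omega
    · exact ⟨s, rfl⟩
    · exact (not_isSource_outflow y (hs ▸ p.isSource_start)).elim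
  · have h := hL.2 p.finish p.isSink_finish
    have hpos : 0 < (L.filter fun q => q.finish = p.finish).card :=
      Finset.card_pos.2 ⟨p, by simp [hp]⟩
    rcases hs : p.finish with v | s | y
    · rw [hs] at h hpos
      simp only [netflow, abs_zero] at h
      omega
    · exact (not_isSink_inflow s (hs ▸ p.isSink_finish)).elim
    · exact ⟨y, rfl⟩

theorem exists_start (hL : A.IsLayering L) (s : VX) : ∃ p ∈ L, p.start = .inr (.inl s) := by
  classical
  have h := hL.1 _ (isSource_inflow s)
  have : 0 < (L.filter fun q => q.start = .inr (.inl s)).card := by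
    simp only [netflow] at h
    omega
  obtain ⟨p, hp⟩ := Finset.card_pos.1 this
  rw [Finset.mem_filter] at hp
  exact ⟨p, hp⟩

theorem eq_of_start_eq (hL : A.IsLayering L) {p q : A.graph.Route} (hp : p ∈ L) (hq : q ∈ L)
    (h : p.start = q.start) : p = q := by
  classical
  obtain ⟨⟨s, hs⟩, -⟩ := hL.isThrough hp
  have h' := hL.1 _ (isSource_inflow s)
  simp only [netflow] at h'
  have h'' : (L.filter fun q => q.start = .inr (.inl s)).card ≤ 1 := by omega
  refine Finset.card_le_one.1 h'' p ?_ q ?_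
  · simp [hp, hs]
  · simp [hq, ← h, hs]

theorem exists_ne_of_ne (hL : A.IsLayering L) (hM : A.IsLayering M) (hne : L ≠ M) :
    ∃ s : VX, ∃ p ∈ L, ∃ q ∈ M, p.start = .inr (.inl s) ∧ q.start = .inr (.inl s) ∧ p ≠ q := by
  by_contra! hcon
  apply hne
  ext p
  constructor
  · intro hp
    obtain ⟨⟨s, hs⟩, -⟩ := hL.isThrough hp
    obtain ⟨q, hq, hqs⟩ := hM.exists_start s
    rw [hcon s p hp q hq hs hqs]
    exact hq
  · intro hp
    obtain ⟨⟨s, hs⟩, -⟩ := hM.isThrough hp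
    obtain ⟨q, hq, hqs⟩ := hL.exists_start s
    rw [← hcon s q hq p hp hqs hs]
    exact hq

end IsLayering

/-! ### The total order on layerings -/

namespace Framing

variable {F : A.Framing} {L M N : Finset A.graph.Route}

theorem srcLT_irrefl (hL : A.IsLayering L) : ¬ F.SrcLT L L := by
  rintro ⟨s, ⟨p, hp, q, hq, hps, hqs, h⟩, -⟩
  obtain rfl := hL.eq_of_start_eq hp hq (hps.trans hqs.symm)
  exact postLT_irrefl _ h

/-- The order is lexicographic with the greatest inflow vertex most significant, so the greater of
the two deciding vertices decides the composite comparison. -/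
theorem srcLT_trans (hL : A.IsLayering L) (hM : A.IsLayering M) (hN : A.IsLayering N)
    (h : F.SrcLT L M) (h' : F.SrcLT M N) : F.SrcLT L N := by
  obtain ⟨s, ⟨p, hp, q, hq, hps, hqs, hlt⟩, hs⟩ := h
  obtain ⟨s', ⟨q', hq', r, hr, hqs', hrs, hlt'⟩, hs'⟩ := h'
  let _ := F.src
  rcases lt_trichotomy s s' with hss | rfl | hss
  · obtain ⟨p', hp', hps'⟩ := hL.exists_start s'
    have := hs s' hss p' hp' q' hq' hps' hqs'
    refine ⟨s', ⟨p', hp', r, hr, hps', hrs, by rwa [this]⟩, fun u hu x hx y hy hxu hyu => ?_⟩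
    obtain ⟨z, hz, hzu⟩ := hM.exists_start u
    exact (hs u (lt_trans hss hu) x hx z hz hxu hzu).trans (hs' u hu z hz y hy hzu hyu)
  · obtain rfl := hM.eq_of_start_eq hq hq' (hqs.trans hqs'.symm)
    refine ⟨s, ⟨p, hp, r, hr, hps, hrs, postLT_trans hlt hlt'⟩, fun u hu x hx y hy hxu hyu => ?_⟩
    obtain ⟨z, hz, hzu⟩ := hM.exists_start u
    exact (hs u hu x hx z hz hxu hzu).trans (hs' u hu z hz y hy hzu hyu)
  · obtain ⟨r', hr', hrs'⟩ := hN.exists_start s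
    have := hs' s hss q hq r' hr' hqs hrs'
    refine ⟨s, ⟨p, hp, r', hr', hps, hrs', by rwa [← this]⟩, fun u hu x hx y hy hxu hyu => ?_⟩
    obtain ⟨z, hz, hzu⟩ := hM.exists_start u
    exact (hs u hu x hx z hz hxu hzu).trans (hs' u (lt_trans hss hu) z hz y hy hzu hyu)

theorem srcLT_total [Finite VX] (hL : A.IsLayering L) (hM : A.IsLayering M) :
    L = M ∨ F.SrcLT L M ∨ F.SrcLT M L := by
  by_cases hne : L = M
  · exact Or.inl hne
  right
  let _ := F.src
  obtain ⟨s, hs, hmax⟩ := (Set.toFinite {s : VX | ∃ p ∈ L, ∃ q ∈ M, p.start = .inr (.inl s) ∧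
    q.start = .inr (.inl s) ∧ p ≠ q}).exists_maximal (hL.exists_ne_of_ne hM hne)
  obtain ⟨p, hp, q, hq, hps, hqs, hpq⟩ := hs
  have hup : ∀ s' : VX, F.src.lt s s' → ∀ p ∈ L, ∀ q ∈ M,
      p.start = .inr (.inl s') → q.start = .inr (.inl s') → p = q := by
    intro s' hs' p hp q hq hps hqs
    by_contra h
    exact absurd (hmax ⟨p, hp, q, hq, hps, hqs, h⟩ (le_of_lt hs')) (not_le_of_gt hs')
  have hst := hps.trans hqs.symm
  rcases postLT_total (F := F) p.isPath (hst ▸ q.isPath) p.isSink_finish q.isSink_finish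
    with h | h | h
  · exact (hpq (Route.ext_of_start hst h)).elim
  · exact Or.inl ⟨s, ⟨p, hp, q, hq, hps, hqs, h⟩, hup⟩
  · exact Or.inr ⟨s, ⟨q, hq, p, hp, hqs, hps, h⟩, fun s' hs' q hq p hp hqs hps =>
      (hup s' hs' p hp q hq hps hqs).symm⟩

theorem srcLT_asymm (hL : A.IsLayering L) (hM : A.IsLayering M) (h : F.SrcLT L M) :
    ¬ F.SrcLT M L := fun hML => srcLT_irrefl hL (srcLT_trans hL hM hL h hML)

/-- A nonempty set of layerings has a smallest element. -/
theorem exists_least [Finite VX] [Finite A.graph.Route] (P : Set (Finset A.graph.Route))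
    (hP : ∀ L ∈ P, A.IsLayering L) (hne : P.Nonempty) :
    ∃ L ∈ P, ∀ M ∈ P, M = L ∨ F.SrcLT L M := by
  classical
  have := Fintype.ofFinite A.graph.Route
  let r : P → P → Prop := fun L M => F.SrcLT L M
  have : IsTrans P r := ⟨fun L M N h h' =>
    srcLT_trans (hP _ L.2) (hP _ M.2) (hP _ N.2) h h'⟩
  have : Std.Irrefl r := ⟨fun L => srcLT_irrefl (hP _ L.2)⟩
  obtain ⟨L, -, hL⟩ := (Finite.wellFounded_of_trans_of_irrefl r).has_min Set.univ
    ⟨⟨_, hne.some_mem⟩, trivial⟩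
  refine ⟨L, L.2, fun M hM => ?_⟩
  rcases srcLT_total (F := F) (hP _ hM) (hP _ L.2) with h | h | h
  · exact Or.inl h
  · exact (hL ⟨M, hM⟩ trivial h).elim
  · exact Or.inr h

end Framing

end Augmentation

/-! ### Decomposition of route weights into layerings -/

namespace Augmentation

open MultiDigraph Classical

variable {V E VX VY EX EY : Type*} [Fintype EX] [Fintype EY]
  {G : MultiDigraph V E} {a : V → ℤ} {A : Augmentation G a VX VY EX EY}

/-- Nonnegative weights on the routes that are, in total, `t` times as large as those of a
layering at each inflow and each outflow vertex. -/
structure IsBalanced [Fintype A.graph.Route] (c : A.graph.Route → ℝ) (t : ℝ) : Prop where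
  nonneg : ∀ p, 0 ≤ c p
  isThrough : ∀ p, c p ≠ 0 → IsThrough p
  sum_start : ∀ s : VX, ∑ p with p.start = .inr (.inl s), c p = t
  sum_finish : ∀ y : VY, ∑ p with p.finish = .inr (.inr y), c p = t * |A.aY y|

theorem IsLayering.sum_start [Fintype A.graph.Route] {L : Finset A.graph.Route} (hL : A.IsLayering L) (s : VX) :
    (∑ p with p.start = .inr (.inl s), if p ∈ L then (1 : ℝ) else 0) = 1 := by
  have h := hL.1 _ (isSource_inflow s)
  rw [← Finset.sum_filter, Finset.filter_filter, Finset.sum_const, nsmul_eq_mul, mul_one]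
  have : (Finset.univ.filter fun p : A.graph.Route => p.start = .inr (.inl s) ∧ p ∈ L) =
      L.filter fun p => p.start = .inr (.inl s) := by
    ext
    simp [and_comm]
  rw [this]
  simp only [netflow] at h
  exact_mod_cast h

theorem IsLayering.sum_finish [Fintype A.graph.Route] {L : Finset A.graph.Route} (hL : A.IsLayering L) (y : VY) :
    (∑ p with p.finish = .inr (.inr y), if p ∈ L then (1 : ℝ) else 0) = |A.aY y| := by
  have h := hL.2 _ (isSink_outflow y)
  rw [← Finset.sum_filter, Finset.filter_filter, Finset.sum_const, nsmul_eq_mul, mul_one]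
  have : (Finset.univ.filter fun p : A.graph.Route => p.finish = .inr (.inr y) ∧ p ∈ L) =
      L.filter fun p => p.finish = .inr (.inr y) := by
    ext
    simp [and_comm]
  rw [this]
  exact_mod_cast h

/-- The weight of a route in a weighted set of layerings. -/
noncomputable def layerSum (S : Finset (Finset A.graph.Route)) (w : Finset A.graph.Route → ℝ)
    (p : A.graph.Route) : ℝ :=
  ∑ L ∈ S, w L * if p ∈ L then 1 else 0

theorem isBalanced_layerSum [Fintype A.graph.Route] {S : Finset (Finset A.graph.Route)}
    (hS : ∀ L ∈ S, A.IsLayering L)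
    {w : Finset A.graph.Route → ℝ} (hw : ∀ L ∈ S, 0 ≤ w L) :
    IsBalanced (layerSum S w) (∑ L ∈ S, w L) where
  nonneg p := Finset.sum_nonneg fun L hL => mul_nonneg (hw L hL) (by split_ifs <;> simp)
  isThrough p hp := by
    obtain ⟨L, hL, h⟩ := Finset.exists_ne_zero_of_sum_ne_zero hp
    have : p ∈ L := by
      by_contra hpL
      simp [hpL] at h
    exact (hS L hL).isThrough this
  sum_start s := by
    simp only [layerSum]
    rw [Finset.sum_comm]
    refine Finset.sum_congr rfl fun L hL => ?_
    rw [← Finset.mul_sum, (hS L hL).sum_start, mul_one]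
  sum_finish y := by
    simp only [layerSum]
    rw [Finset.sum_comm, Finset.sum_mul]
    refine Finset.sum_congr rfl fun L hL => ?_
    rw [← Finset.mul_sum, (hS L hL).sum_finish]

theorem layerSum_ne_zero_iff {S : Finset (Finset A.graph.Route)} {w : Finset A.graph.Route → ℝ}
    (hw : ∀ L ∈ S, 0 < w L) (p : A.graph.Route) :
    layerSum S w p ≠ 0 ↔ p ∈ A.routes (S : Set (Finset A.graph.Route)) := by
  rw [layerSum, Ne, Finset.sum_eq_zero_iff_of_nonneg fun L hL =>
    mul_nonneg (hw L hL).le (by split_ifs <;> simp)]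
  simp only [routes, Finset.mem_coe, Set.mem_ofPred_eq]
  push Not
  refine exists_congr fun L => and_congr_right fun hL => ?_
  simp [ne_of_gt (hw L hL)]

/-- The places at which the routes of a layering may end. -/
abbrev Slot (A : Augmentation G a VX VY EX EY) : Type _ := Σ y : VY, Fin (A.aY y).natAbs

theorem card_slot_cast [Fintype VY] (Y : Finset VY) :
    ((Finset.univ.filter fun k : A.Slot => k.1 ∈ Y).card : ℝ) = ∑ y ∈ Y, (|A.aY y| : ℤ) := by
  have : (Finset.univ.filter fun k : A.Slot => k.1 ∈ Y) = Y.sigma fun _ => Finset.univ := by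
    ext
    simp
  rw [this, Finset.card_sigma]
  simp

/-- Balanced weights are a fractional perfect matching of inflow vertices with slots, where a vertex
is adjacent to the slots of all outflow vertices that it reaches by a route of nonzero weight.
Hall's theorem makes the matching integral. -/
theorem IsBalanced.exists_layering [Fintype VX] [Fintype VY] [Fintype A.graph.Route]
    {c : A.graph.Route → ℝ} {t : ℝ} (hc : IsBalanced c t) (ht : 0 < t) : ∃ L, A.IsLayering L ∧ ∀ p ∈ L, c p ≠ 0 := by
  let T : VX → Finset VY := fun s => Finset.univ.filter fun y =>
    ∃ p : A.graph.Route, c p ≠ 0 ∧ p.start = .inr (.inl s) ∧ p.finish = .inr (.inr y)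
  let N : VX → Finset A.Slot := fun s => Finset.univ.filter fun k => k.1 ∈ T s
  have hall : ∀ X : Finset VX, X.card ≤ (X.biUnion N).card := by
    intro X
    have hN : X.biUnion N = Finset.univ.filter fun k : A.Slot => k.1 ∈ X.biUnion T := by
      ext
      simp [N]
    have h₁ : ∑ s ∈ X, ∑ p with p.start = .inr (.inl s), c p =
        ∑ p with ∃ s ∈ X, p.start = .inr (.inl s), c p := by
      rw [← Finset.sum_biUnion]
      · congr 1
        ext
        simp
      · intro s _ s' _ hne
        refine Finset.disjoint_left.2 fun p hp hp' => hne ?_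
        simp only [Finset.mem_filter, Finset.mem_univ, true_and] at hp hp'
        simpa using hp.symm.trans hp'
    have h₂ : ∑ y ∈ X.biUnion T, ∑ p with p.finish = .inr (.inr y), c p =
        ∑ p with ∃ y ∈ X.biUnion T, p.finish = .inr (.inr y), c p := by
      rw [← Finset.sum_biUnion]
      · congr 1
        ext
        simp
      · intro s _ s' _ hne
        refine Finset.disjoint_left.2 fun p hp hp' => hne ?_
        simp only [Finset.mem_filter, Finset.mem_univ, true_and] at hp hp'
        simpa using hp.symm.trans hp'
    -- Every weighted route that starts in `X` ends at a neighbour of `X`; after division by `t`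
    -- this is Hall's condition.
    have h₃ : ∑ p with ∃ s ∈ X, p.start = .inr (.inl s), c p ≤
        ∑ p with ∃ y ∈ X.biUnion T, p.finish = .inr (.inr y), c p := by
      rw [Finset.sum_filter, Finset.sum_filter]
      refine Finset.sum_le_sum fun p _ => ?_
      by_cases hp : c p = 0
      · simp [hp]
      by_cases hX : ∃ s ∈ X, p.start = .inr (.inl s)
      · rw [if_pos hX, if_pos]
        obtain ⟨s, hs, hps⟩ := hX
        obtain ⟨-, y, hy⟩ := hc.isThrough p hp
        exact ⟨y, Finset.mem_biUnion.2 ⟨s, hs, by simpa [T] using ⟨p, hp, hps, hy⟩⟩, hy⟩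
      · rw [if_neg hX]
        split_ifs
        · exact hc.nonneg p
        · exact le_rfl
    rw [← h₁, ← h₂] at h₃
    simp only [hc.sum_start, hc.sum_finish, Finset.sum_const, nsmul_eq_mul] at h₃
    rw [← Finset.mul_sum, mul_comm] at h₃
    have h₄ := le_of_mul_le_mul_left h₃ ht
    have h₅ := card_slot_cast (A := A) (X.biUnion T)
    rw [← hN] at h₅
    have h₆ : (X.card : ℝ) ≤ (X.biUnion N).card := by
      rw [h₅]
      push_cast at h₄ ⊢
      exact h₄
    exact_mod_cast h₆
  obtain ⟨f, hf, hfN⟩ := (Finset.all_card_le_biUnion_card_iff_exists_injective N).1 hall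
  -- Counting the total weight by starts and by ends shows that there are as many inflow vertices as
  -- slots. So the matching is bijective and fills each outflow vertex exactly.
  have hcard : Fintype.card VX = Fintype.card A.Slot := by
    have h₁ : ∑ s : VX, ∑ p with p.start = .inr (.inl s), c p = ∑ p, c p := by
      rw [← Finset.sum_biUnion]
      · refine Finset.sum_subset (Finset.subset_univ _) fun p _ hp => ?_
        by_contra h
        obtain ⟨⟨s, hs⟩, -⟩ := hc.isThrough p h
        exact hp (by simp [hs])
      · intro s _ s' _ hne
        refine Finset.disjoint_left.2 fun p hp hp' => hne ?_
        simp only [Finset.mem_filter, Finset.mem_univ, true_and] at hp hp'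
        simpa using hp.symm.trans hp'
    have h₂ : ∑ y : VY, ∑ p with p.finish = .inr (.inr y), c p = ∑ p, c p := by
      rw [← Finset.sum_biUnion]
      · refine Finset.sum_subset (Finset.subset_univ _) fun p _ hp => ?_
        by_contra h
        obtain ⟨-, y, hy⟩ := hc.isThrough p h
        exact hp (by simp [hy])
      · intro s _ s' _ hne
        refine Finset.disjoint_left.2 fun p hp hp' => hne ?_
        simp only [Finset.mem_filter, Finset.mem_univ, true_and] at hp hp'
        simpa using hp.symm.trans hp'
    rw [← h₂] at h₁
    simp only [hc.sum_start, hc.sum_finish, Finset.sum_const, nsmul_eq_mul] at h₁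
    rw [← Finset.mul_sum, mul_comm] at h₁
    have h₄ := mul_left_cancel₀ ht.ne' h₁
    have h₅ := card_slot_cast (A := A) Finset.univ
    simp only [Finset.mem_univ, Finset.filter_true] at h₅
    have h₆ : (Fintype.card VX : ℝ) = Fintype.card A.Slot := by
      rw [Fintype.card, h₄, Fintype.card, h₅]
      push_cast
      rfl
    exact_mod_cast h₆
  have hbij := (Fintype.bijective_iff_injective_and_card f).2 ⟨hf, hcard⟩
  have hex : ∀ s, ∃ p : A.graph.Route, c p ≠ 0 ∧ p.start = .inr (.inl s) ∧
      p.finish = .inr (.inr (f s).1) := fun s => by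
    have := hfN s
    simpa [N, T] using this
  choose p hp hps hpf using hex
  have hinj : Function.Injective p := fun s s' h => by
    have := (hps s).symm.trans ((congrArg Route.start h).trans (hps s'))
    simpa using this
  refine ⟨Finset.univ.image p, ⟨fun i hi => ?_, fun j hj => ?_⟩, ?_⟩
  · rw [Finset.filter_image, Finset.card_image_of_injective _ hinj]
    simp only [hps]
    rcases i with v | s | y
    · simp [netflow]
    · have : (Finset.univ.filter fun s' : VX => s' = s).card = 1 := by
        rw [Finset.card_eq_one]
        exact ⟨s, by ext; simp⟩
      simpa [netflow] using this
    · exact (not_isSource_outflow y hi).elim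
  · rw [Finset.filter_image, Finset.card_image_of_injective _ hinj]
    simp only [hpf]
    rcases j with v | s | y
    · simp [netflow]
    · exact (not_isSink_inflow s hj).elim
    · have : (Finset.univ.filter fun s : VX =>
          (Sum.inr (Sum.inr (f s).1) : V ⊕ VX ⊕ VY) = .inr (.inr y)).card =
          (Finset.univ.filter fun k : A.Slot => k.1 ∈ ({y} : Finset VY)).card := by
        refine Finset.card_bij (fun s _ => f s) ?_ ?_ ?_
        · intro s hs
          simpa using hs
        · intro s _ s' _ h
          exact hf h
        · intro k hk
          obtain ⟨s, rfl⟩ := hbij.2 k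
          exact ⟨s, by simpa using hk, rfl⟩
      rw [this]
      have h := card_slot_cast (A := A) {y}
      rw [Finset.sum_singleton] at h
      simp only [netflow]
      exact_mod_cast h
  · intro q hq
    obtain ⟨s, -, rfl⟩ := Finset.mem_image.1 hq
    exact hp s

/-! ### Layering-simplices and their route weights -/

namespace Framing

variable {F : A.Framing}

/-- The last two conditions compare a layering with the routes of itself and later members only, and
these sets shrink when members are dropped. -/
theorem IsLayeringSimplex.mono {S T : Finset (Finset A.graph.Route)} (hS : F.IsLayeringSimplex S)
    (hT : T ⊆ S) : F.IsLayeringSimplex T where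
  isLayering L hL := hS.isLayering L (hT hL)
  isRouteClique := by
    rintro p ⟨L, hL, hp⟩ q ⟨M, hM, hq⟩
    exact hS.isRouteClique p ⟨L, hT hL, hp⟩ q ⟨M, hT hM, hq⟩
  isMin L hL M hM h := hS.isMin L (hT hL) M hM fun p hp => by
    obtain ⟨N, ⟨hN, h'⟩, hpN⟩ := h p hp
    exact ⟨N, ⟨hT hN, h'⟩, hpN⟩
  exists_new L hL := by
    obtain ⟨p, hp, h⟩ := hS.exists_new L (hT hL)
    refine ⟨p, hp, fun ⟨N, ⟨hN, h'⟩, hpN⟩ => h ⟨N, ⟨hT hN, h'⟩, hpN⟩⟩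

/-- The set of the layerings of a simplex has a smallest element. -/
theorem IsLayeringSimplex.exists_least [Finite VX] [Finite A.graph.Route]
    {S : Finset (Finset A.graph.Route)}
    (hS : F.IsLayeringSimplex S) (hne : S.Nonempty) :
    ∃ L ∈ S, ∀ M ∈ S, M = L ∨ F.SrcLT L M :=
  Framing.exists_least (S : Set (Finset A.graph.Route)) hS.isLayering hne

/-- A route of the least member that no later member uses receives weight from that member alone, so
the coefficient can be read off there. -/
theorem layerSum_eq_of_least {S : Finset (Finset A.graph.Route)} {w : Finset A.graph.Route → ℝ}
    {L : Finset A.graph.Route} (hL : L ∈ S) {p : A.graph.Route} (hp : p ∈ L)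
    (hlast : ∀ M ∈ S, M = L ∨ F.SrcLT L M) (hnew : p ∉ A.routes {N | N ∈ S ∧ F.SrcLT L N}) :
    layerSum S w p = w L := by
  rw [layerSum, Finset.sum_eq_single L]
  · simp [hp]
  · intro M hM hne
    have : p ∉ M := fun h => hnew ⟨M, ⟨hM, (hlast M hM).resolve_left hne⟩, h⟩
    simp [this]
  · exact fun h => (h hL).elim

theorem le_layerSum {S : Finset (Finset A.graph.Route)} {w : Finset A.graph.Route → ℝ}
    (hw : ∀ L ∈ S, 0 < w L) {L : Finset A.graph.Route} (hL : L ∈ S) {p : A.graph.Route}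
    (hp : p ∈ L) : w L ≤ layerSum S w p := by
  have := Finset.single_le_sum (f := fun L => w L * if p ∈ L then (1 : ℝ) else 0)
    (fun M hM => mul_nonneg (hw M hM).le (by split_ifs <;> simp)) hL
  simpa only [hp, if_true, mul_one, layerSum] using this

theorem layerSum_erase {S : Finset (Finset A.graph.Route)} {w : Finset A.graph.Route → ℝ}
    {L : Finset A.graph.Route} (hL : L ∈ S) (p : A.graph.Route) :
    layerSum (S.erase L) w p = layerSum S w p - w L * if p ∈ L then 1 else 0 := by
  rw [layerSum, layerSum, ← Finset.sum_erase_add S _ hL]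
  ring

theorem routes_of_least {S : Finset (Finset A.graph.Route)} {L : Finset A.graph.Route}
    (hlast : ∀ M ∈ S, M = L ∨ F.SrcLT L M) :
    A.routes {N | N ∈ S ∧ (N = L ∨ F.SrcLT L N)} = A.routes (S : Set (Finset A.graph.Route)) := by
  ext p
  exact ⟨fun ⟨N, hN, hp⟩ => ⟨N, hN.1, hp⟩, fun ⟨N, hN, hp⟩ => ⟨N, ⟨hN, hlast N hN⟩, hp⟩⟩

/-- The layerings of a layering-simplex and their weights are determined by the weights of the
routes. -/
theorem IsLayeringSimplex.unique [Finite VX] [Finite A.graph.Route]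
    {S T : Finset (Finset A.graph.Route)} (hS : F.IsLayeringSimplex S) (hT : F.IsLayeringSimplex T) {v w : Finset A.graph.Route → ℝ}
    (hv : ∀ L ∈ S, 0 < v L) (hw : ∀ L ∈ T, 0 < w L) (h : ∀ p, layerSum S v p = layerSum T w p) :
    S = T ∧ ∀ L ∈ S, v L = w L := by
  induction hn : S.card generalizing S T with
  | zero =>
    rw [Finset.card_eq_zero] at hn
    subst hn
    refine ⟨?_, by simp⟩
    by_contra hne
    obtain ⟨L, hL⟩ := Finset.nonempty_iff_ne_empty.2 (Ne.symm hne)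
    obtain ⟨p, hp, -⟩ := hT.exists_new L hL
    have := (layerSum_ne_zero_iff hw p).2 ⟨L, hL, hp⟩
    rw [← h] at this
    simp [layerSum] at this
  | succ n ih =>
    have hSne : S.Nonempty := Finset.card_pos.1 (by omega)
    have hroutes : A.routes (S : Set (Finset A.graph.Route)) =
        A.routes (T : Set (Finset A.graph.Route)) := by
      ext p
      rw [← layerSum_ne_zero_iff hv, ← layerSum_ne_zero_iff hw, h]
    obtain ⟨L, hL, hLmin⟩ := hS.exists_least hSne
    have hTne : T.Nonempty := by
      obtain ⟨p, hp, -⟩ := hS.exists_new L hL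
      have : p ∈ A.routes (T : Set (Finset A.graph.Route)) := hroutes ▸ ⟨L, hL, hp⟩
      obtain ⟨M, hM, -⟩ := this
      exact ⟨M, hM⟩
    obtain ⟨M, hM, hMmin⟩ := hT.exists_least hTne
    -- Both families use the same routes, namely those of nonzero weight, and each least member is
    -- the smallest layering inside this set.
    have h₁ := hS.isMin L hL M (hT.isLayering M hM) fun p hp => by
      rw [routes_of_least hLmin, hroutes]
      exact ⟨M, hM, hp⟩
    have h₂ := hT.isMin M hM L (hS.isLayering L hL) fun p hp => by
      rw [routes_of_least hMmin, ← hroutes]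
      exact ⟨L, hL, hp⟩
    have hLM : L = M := by
      rcases h₁ with h₁ | h₁
      · exact h₁.symm
      · rcases h₂ with h₂ | h₂
        · exact h₂
        · exact (srcLT_asymm (hS.isLayering L hL) (hT.isLayering M hM) h₁ h₂).elim
    subst hLM
    -- The new route of either simplex has weight equal to the coefficient of `L` there, and at
    -- least the coefficient of `L` in the other simplex.
    have hvw : v L = w L := by
      obtain ⟨p, hp, hnew⟩ := hS.exists_new L hL
      obtain ⟨q, hq, hnew'⟩ := hT.exists_new L hM
      have e₁ := layerSum_eq_of_least (w := v) hL hp hLmin hnew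
      have e₂ := layerSum_eq_of_least (w := w) hM hq hMmin hnew'
      have e₃ := le_layerSum hv hL hq
      have e₄ := le_layerSum hw hM hp
      rw [h] at e₁ e₃
      linarith
    obtain ⟨h₃, h₄⟩ := ih (hS.mono (S.erase_subset L)) (hT.mono (T.erase_subset L))
      (fun N hN => hv N (Finset.mem_of_mem_erase hN)) (fun N hN => hw N (Finset.mem_of_mem_erase hN))
      (fun p => by rw [layerSum_erase hL, layerSum_erase hM, h, hvw])
      (by rw [Finset.card_erase_of_mem hL]; omega)
    refine ⟨?_, fun N hN => ?_⟩
    · rw [← Finset.insert_erase hL, h₃, Finset.insert_erase hM]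
    · by_cases hNL : N = L
      · rw [hNL, hvw]
      · exact h₄ N (Finset.mem_erase.2 ⟨hNL, hN⟩)

/-- Balanced weights on a route-clique are the weights of a layering-simplex. -/
theorem exists_layerSum_eq [Fintype VX] [Fintype VY] [Nonempty VX] [Fintype A.graph.Route]
    {c : A.graph.Route → ℝ} {t : ℝ}
    (ht : 0 ≤ t) (hc : IsBalanced c t) (hcl : F.IsRouteClique {p | c p ≠ 0}) :
    ∃ S w, F.IsLayeringSimplex S ∧ (∀ L ∈ S, 0 < w L) ∧ ∀ p, c p = layerSum S w p := by
  induction hn : (Finset.univ.filter fun p => c p ≠ 0).card using Nat.strong_induction_on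
    generalizing c t with
  | h n ih =>
    rcases ht.eq_or_lt with rfl | ht
    · refine ⟨∅, fun _ => 0, ⟨by simp, ?_, by simp, by simp⟩, by simp, fun p => ?_⟩
      · rintro p ⟨L, hL, -⟩
        simp at hL
      · by_contra hp
        have hp' : c p ≠ 0 := by simpa [layerSum] using hp
        obtain ⟨⟨s, hs⟩, -⟩ := hc.isThrough p hp'
        have := (Finset.sum_eq_zero_iff_of_nonneg fun q _ => hc.nonneg q).1 (hc.sum_start s) p
          (by simp [hs])
        exact hp' this
    -- Greedy step: take the least layering in the support and subtract it as often as its lightest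
    -- route `p₀` allows. The support loses `p₀`, which drives the induction.
    · obtain ⟨L, ⟨hL, hLc⟩, hmin⟩ := Framing.exists_least (F := F)
        {L : Finset A.graph.Route | A.IsLayering L ∧ ∀ p ∈ L, c p ≠ 0} (fun L h => h.1)
        (hc.exists_layering ht)
      -- Without inflow vertices the only layering would be empty, with no lightest route.
      have hLne : L.Nonempty := by
        obtain ⟨p, hp, -⟩ := hL.exists_start (Classical.arbitrary VX)
        exact ⟨p, hp⟩
      obtain ⟨p₀, hp₀, hp₀min⟩ := L.exists_min_image c hLne
      have hpos : 0 < c p₀ := (hc.nonneg p₀).lt_of_ne' (hLc p₀ hp₀)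
      let c' : A.graph.Route → ℝ := fun p => c p - c p₀ * if p ∈ L then 1 else 0
      have hsub : ∀ p, c' p ≠ 0 → c p ≠ 0 := by
        intro p hp hcp
        apply hp
        have : p ∉ L := fun h => hLc p h hcp
        simp [c', this, hcp]
      have hc'₀ : c' p₀ = 0 := by simp [c', hp₀]
      have ht' : 0 ≤ t - c p₀ := by
        obtain ⟨⟨s, hs⟩, -⟩ := hL.isThrough hp₀
        have := Finset.single_le_sum (f := c) (fun q _ => hc.nonneg q)
          (show p₀ ∈ Finset.univ.filter fun p => p.start = .inr (.inl s) by simp [hs])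
        rw [hc.sum_start] at this
        linarith
      have hc' : IsBalanced c' (t - c p₀) := by
        refine ⟨fun p => ?_, fun p hp => hc.isThrough p (hsub p hp), fun s => ?_, fun y => ?_⟩
        · by_cases hp : p ∈ L
          · simpa [c', hp] using hp₀min p hp
          · simpa [c', hp] using hc.nonneg p
        · rw [Finset.sum_sub_distrib, hc.sum_start, ← Finset.mul_sum, hL.sum_start, mul_one]
        · rw [Finset.sum_sub_distrib, hc.sum_finish, ← Finset.mul_sum, hL.sum_finish]
          ring
      obtain ⟨S, w, hS, hw, hcS⟩ := ih _ (by
        rw [← hn]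
        refine Finset.card_lt_card (Finset.ssubset_iff_subset_ne.2 ⟨fun p hp => ?_, fun h => ?_⟩)
        · simp only [Finset.mem_filter, Finset.mem_univ, true_and] at hp ⊢
          exact hsub p hp
        · have : p₀ ∈ Finset.univ.filter fun p => c p ≠ 0 := by simp [hpos.ne']
          rw [← h] at this
          simp [hc'₀] at this) ht' hc' (fun p hp q hq => hcl p (hsub p hp) q (hsub q hq)) rfl
      have hSc : ∀ M ∈ S, ∀ p ∈ M, c' p ≠ 0 := by
        intro M hM p hp
        rw [hcS, layerSum_ne_zero_iff hw]
        exact ⟨M, hM, hp⟩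
      -- The remaining members avoid `p₀`, so they differ from `L` and lie above it, and `p₀` is the
      -- new route that `L` must have.
      have hLS : L ∉ S := fun h => hSc L h p₀ hp₀ hc'₀
      have hlt : ∀ M ∈ S, F.SrcLT L M := by
        intro M hM
        refine (hmin M ⟨hS.isLayering M hM, fun p hp => hsub p (hSc M hM p hp)⟩).resolve_left ?_
        rintro rfl
        exact hLS hM
      have hnlt : ∀ M ∈ S, ¬ F.SrcLT M L := fun M hM =>
        srcLT_asymm hL (hS.isLayering M hM) (hlt M hM)
      refine ⟨insert L S, Function.update w L (c p₀), ⟨?_, ?_, ?_, ?_⟩, ?_, ?_⟩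
      · intro M hM
        rcases Finset.mem_insert.1 hM with rfl | hM
        · exact hL
        · exact hS.isLayering M hM
      · have : ∀ p ∈ A.routes ((insert L S : Finset _) : Set (Finset A.graph.Route)), c p ≠ 0 := by
          rintro p ⟨M, hM, hp⟩
          rcases Finset.mem_insert.1 hM with rfl | hM
          · exact hLc p hp
          · exact hsub p (hSc M hM p hp)
        exact fun p hp q hq => hcl p (this p hp) q (this q hq)
      · intro M hM N hN hNr
        rcases Finset.mem_insert.1 hM with rfl | hM'
        · refine hmin N ⟨hN, fun p hp => ?_⟩
          obtain ⟨K, ⟨hK, -⟩, hpK⟩ := hNr p hp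
          rcases Finset.mem_insert.1 hK with rfl | hK
          · exact hLc p hpK
          · exact hsub p (hSc K hK p hpK)
        · refine hS.isMin M hM' N hN fun p hp => ?_
          obtain ⟨K, ⟨hK, hK'⟩, hpK⟩ := hNr p hp
          rcases Finset.mem_insert.1 hK with rfl | hK
          · rcases hK' with rfl | hK'
            · exact (hLS hM').elim
            · exact (hnlt M hM' hK').elim
          · exact ⟨K, ⟨hK, hK'⟩, hpK⟩
      · intro M hM
        rcases Finset.mem_insert.1 hM with rfl | hM'
        · refine ⟨p₀, hp₀, ?_⟩
          rintro ⟨K, ⟨hK, hK'⟩, hpK⟩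
          rcases Finset.mem_insert.1 hK with rfl | hK
          · exact srcLT_irrefl hL hK'
          · exact hSc K hK p₀ hpK hc'₀
        · obtain ⟨p, hp, hnew⟩ := hS.exists_new M hM'
          refine ⟨p, hp, ?_⟩
          rintro ⟨K, ⟨hK, hK'⟩, hpK⟩
          rcases Finset.mem_insert.1 hK with rfl | hK
          · exact hnlt M hM' hK'
          · exact hnew ⟨K, ⟨hK, hK'⟩, hpK⟩
      · intro M hM
        rcases Finset.mem_insert.1 hM with rfl | hM
        · simpa using hpos
        · rw [Function.update_of_ne (fun h : M = L => hLS (h ▸ hM))]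
          exact hw M hM
      · intro p
        rw [layerSum, Finset.sum_insert hLS, Function.update_self]
        have : ∑ M ∈ S, Function.update w L (c p₀) M * (if p ∈ M then 1 else 0) = c' p := by
          rw [hcS, layerSum]
          refine Finset.sum_congr rfl fun M hM => ?_
          rw [Function.update_of_ne (fun h : M = L => hLS (h ▸ hM))]
        rw [this]
        simp only [c']
        ring

end Framing

end Augmentation

/-! ### Flows of the graph and of its augmentation -/

namespace Augmentation

open MultiDigraph Classical

variable {V E VX VY EX EY : Type*} [Fintype EX] [Fintype EY]
  {G : MultiDigraph V E} {a : V → ℤ} {A : Augmentation G a VX VY EX EY}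

/-- The extension of a flow of `G` with netflow `t • a` to the augmented graph. -/
noncomputable def augFlow (A : Augmentation G a VX VY EX EY) (f : E → ℝ) (t : ℝ) :
    E ⊕ EX ⊕ EY → ℝ
  | .inl e => f e
  | .inr (.inl _) => t
  | .inr (.inr y) => t * |A.aY (A.yHead y)|

theorem sum_inflow (v : V) : (∑ x with A.xHead x = v, (1 : ℝ)) = max (a v : ℝ) 0 := by
  rw [Finset.sum_const, nsmul_eq_mul, mul_one]
  rcases lt_or_ge 0 (a v) with h | h
  · rw [max_eq_left (by exact_mod_cast h.le)]
    exact_mod_cast A.card_xHead v h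
  · rw [max_eq_right (by exact_mod_cast h)]
    have : (Finset.univ.filter fun x => A.xHead x = v) = ∅ := by
      ext x
      have := A.xHead_pos x
      simp only [Finset.mem_filter, Finset.mem_univ, true_and, Finset.notMem_empty, iff_false]
      rintro rfl
      omega
    simp [this]

theorem sum_outflow (v : V) :
    (∑ y with A.yTail y = v, ((|A.aY (A.yHead y)| : ℤ) : ℝ)) = max (-(a v : ℝ)) 0 := by
  rcases lt_or_ge (a v) 0 with h | h
  · rw [max_eq_left (by have : (a v : ℝ) < 0 := by exact_mod_cast h
                        linarith)]
    have h' := A.sum_aY v h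
    have : ∑ y with A.yTail y = v, |A.aY (A.yHead y)| = - a v := by
      rw [h', ← Finset.sum_neg_distrib]
      exact Finset.sum_congr rfl fun y _ => abs_of_neg (A.aY_neg _)
    exact_mod_cast this
  · rw [max_eq_right (by have : (0 : ℝ) ≤ a v := by exact_mod_cast h
                         linarith)]
    have : (Finset.univ.filter fun y => A.yTail y = v) = ∅ := by
      ext x
      have := A.yTail_neg x
      simp only [Finset.mem_filter, Finset.mem_univ, true_and, Finset.notMem_empty, iff_false]
      rintro rfl
      omega
    simp [this]

/-- The outflow and inflow edges at `v` contribute `t` times the negative and the positive part of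
`a v`, whose difference is `-t * a v`. Netflow `t • a` on `G` thus means conservation on the
augmented graph. -/
theorem netflow_augFlow [Fintype E] (f : E → ℝ) (t : ℝ) (v : V) :
    (∑ e with A.graph.tail e = .inl v, A.augFlow f t e) -
      (∑ e with A.graph.head e = .inl v, A.augFlow f t e) =
    (∑ e with G.tail e = v, f e) - (∑ e with G.head e = v, f e) - t * a v := by
  have h₁ : ∑ e with A.graph.tail e = .inl v, A.augFlow f t e =
      (∑ e with G.tail e = v, f e) + t * max (-(a v : ℝ)) 0 := by
    rw [← A.sum_outflow v, Finset.mul_sum, Finset.sum_filter, Fintype.sum_sum_type, Fintype.sum_sum_type]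
    simp [Finset.sum_filter, graph, augFlow]
  have h₂ : ∑ e with A.graph.head e = .inl v, A.augFlow f t e =
      (∑ e with G.head e = v, f e) + t * max (a v : ℝ) 0 := by
    rw [← A.sum_inflow v, Finset.mul_sum, Finset.sum_filter, Fintype.sum_sum_type, Fintype.sum_sum_type]
    simp [Finset.sum_filter, graph, augFlow, -Finset.sum_const, -Finset.sum_boole]
  have h₃ : max (-(a v : ℝ)) 0 - max (a v : ℝ) 0 = - a v := by
    rcases le_total 0 (a v : ℝ) with h | h
    · rw [max_eq_left h, max_eq_right (by linarith)]
      ring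
    · rw [max_eq_right h, max_eq_left (by linarith)]
      ring
  rw [h₁, h₂]
  linear_combination t * h₃

theorem augFlow_conserved [Fintype E] {f : E → ℝ} {t : ℝ}
    (hf : ∀ v, (∑ e with G.tail e = v, f e) - (∑ e with G.head e = v, f e) = t * a v) (v : V) :
    ∑ e with A.graph.head e = .inl v, A.augFlow f t e =
      ∑ e with A.graph.tail e = .inl v, A.augFlow f t e := by
  have := A.netflow_augFlow f t v
  rw [hf] at this
  linarith

theorem isConserved_of_inl [Fintype E] {H : E ⊕ EX ⊕ EY → ℝ}
    (h : ∀ v, ∑ e with A.graph.head e = .inl v, H e = ∑ e with A.graph.tail e = .inl v, H e) :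
    A.graph.IsConserved H := by
  rintro (v | s | y) h₁ h₂
  · convert h v
  · exact (h₁ (isSource_inflow s)).elim
  · exact (h₂ (isSink_outflow y)).elim

/-- The tail of `x` is a source with no other outgoing edge. This and its dual turn weights at
starts and ends of routes into flow on inflow and outflow edges. -/
theorem inflow_mem_edges_iff (p : A.graph.Route) (x : EX) :
    .inr (.inl x) ∈ p.edges ↔ p.start = .inr (.inl (A.xTail x)) := by
  constructor
  · intro h
    obtain ⟨l₁, l₂, hl⟩ := List.append_of_mem h
    by_cases hs : A.graph.IsSource (A.graph.tail (.inr (.inl x)))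
    · have hp := p.isPath
      rw [hl, isPath_append] at hp
      obtain ⟨w, h₁, h₂⟩ := hp
      rcases List.eq_nil_or_concat l₁ with rfl | ⟨l, e, rfl⟩
      · exact Eq.trans h₁ h₂.1.symm
      · rw [List.concat_eq_append, isPath_append] at h₁
        obtain ⟨w', -, h₁⟩ := h₁
        exact (hs e (h₁.2.trans h₂.1.symm)).elim
    · exact (hs (isSource_inflow _)).elim
  · intro h
    have hp := p.isPath
    cases he : p.edges with
    | nil =>
      rw [he, h] at hp
      exact (not_isSink_inflow _ (hp ▸ p.isSink_finish)).elim
    | cons e l =>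
      rw [he, h] at hp
      have h₁ := hp.1
      rcases e with e | x' | y <;> simp [graph] at h₁
      rw [(A.existsUnique_x _).unique h₁ rfl]
      simp

theorem outflow_mem_edges_iff (p : A.graph.Route) (y : EY) :
    .inr (.inr y) ∈ p.edges ↔ p.finish = .inr (.inr (A.yHead y)) := by
  constructor
  · intro h
    obtain ⟨l₁, l₂, hl⟩ := List.append_of_mem h
    have hp := p.isPath
    rw [hl, isPath_append] at hp
    obtain ⟨w, -, h₂⟩ := hp
    cases l₂ with
    | nil => exact h₂.2.symm
    | cons e l => exact (isSink_outflow _ e h₂.2.1).elim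
  · intro h
    have hp := p.isPath
    rcases List.eq_nil_or_concat p.edges with he | ⟨l, e, he⟩
    · rw [he, h] at hp
      exact (not_isSource_outflow _ ((show p.start = _ from hp) ▸ p.isSource_start)).elim
    · rw [he, h, List.concat_eq_append, isPath_append] at hp
      obtain ⟨w', -, h₁⟩ := hp
      have h₁ := h₁.2
      rcases e with e | x' | y' <;> simp [IsPath, graph] at h₁
      rw [he, (A.existsUnique_y _).unique h₁ rfl]
      simp

theorem layeringIndicator_apply (L : Finset A.graph.Route) (e : E) :
    A.layeringIndicator L e = ∑ p ∈ L, if Sum.inl e ∈ p.edges then (1 : ℝ) else 0 := by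
  simp [layeringIndicator, routeIndicator]

theorem isIntegerPoint_layeringIndicator (L : Finset A.graph.Route) :
    IsIntegerPoint (A.layeringIndicator L) := fun e =>
  ⟨∑ p ∈ L, if .inl e ∈ p.edges then 1 else 0, by
    rw [layeringIndicator_apply]
    push_cast
    rfl⟩

namespace Framing

variable {F : A.Framing}

theorem IsRouteClique.not_crosses {R : Set A.graph.Route} (hR : F.IsRouteClique R)
    {p q : A.graph.Route} (hp : p ∈ R) (hq : q ∈ R) :
    ¬ Crosses F.OutLT F.IncLT p.edges q.edges := fun h =>
  (hR p hp q hq).1 (cross_iff.2 h)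

theorem IsLayeringSimplex.isRouteClique_layerSum {S : Finset (Finset A.graph.Route)}
    (hS : F.IsLayeringSimplex S) {w : Finset A.graph.Route → ℝ} (hw : ∀ L ∈ S, 0 < w L) :
    F.IsRouteClique {p | layerSum S w p ≠ 0} := fun p hp q hq =>
  hS.isRouteClique p ((layerSum_ne_zero_iff hw p).1 hp) q ((layerSum_ne_zero_iff hw q).1 hq)

end Framing

end Augmentation

/-! ### The netflow of a weighted sum of routes -/

namespace MultiDigraph

open Classical

variable {V E : Type*} {G : MultiDigraph V E}

/-- Telescoping: the head of each edge is the tail of the next, so only the endpoints survive. -/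
theorem IsPath.sum_tail_sub_sum_head {u w : V} {l : List E} (h : G.IsPath u l w) (v : V) :
    (l.map fun e => if G.tail e = v then (1 : ℝ) else 0).sum -
      (l.map fun e => if G.head e = v then (1 : ℝ) else 0).sum =
    (if u = v then 1 else 0) - if w = v then 1 else 0 := by
  induction l generalizing u with
  | nil => simp [show u = w from h]
  | cons e l ih =>
    have := ih h.2
    simp only [List.map_cons, List.sum_cons, h.1]
    linarith

theorem sum_routeFlow [Fintype E] [Fintype G.Route] (hG : G.IsDAG) (c : G.Route → ℝ) (t : E → V)
    (v : V) : ∑ e with t e = v, routeFlow c e =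
      ∑ p : G.Route, c p * (p.edges.map fun e => if t e = v then (1 : ℝ) else 0).sum := by
  simp only [routeFlow, Finset.sum_filter]
  have : ∀ e, (if t e = v then ∑ p : G.Route, (if e ∈ p.edges then c p else 0) else 0) =
      ∑ p : G.Route, c p * if e ∈ p.edges then (if t e = v then 1 else 0) else 0 := by
    intro e
    split_ifs <;> simp
  simp only [this]
  rw [Finset.sum_comm]
  refine Finset.sum_congr rfl fun p _ => ?_
  rw [← Finset.mul_sum, ← List.sum_toFinset _ (hG.nodup p.isPath), ← Finset.sum_filter]
  congr 2
  ext
  simp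

theorem routeFlow_conserved [Fintype E] [Fintype G.Route] (hG : G.IsDAG) {c : G.Route → ℝ} {v : V}
    (hv : ∀ p, c p ≠ 0 → p.start ≠ v ∧ p.finish ≠ v) :
    ∑ e with G.head e = v, routeFlow c e = ∑ e with G.tail e = v, routeFlow c e := by
  rw [sum_routeFlow hG, sum_routeFlow hG]
  refine Finset.sum_congr rfl fun p _ => ?_
  by_cases hp : c p = 0
  · simp [hp]
  · have := p.isPath.sum_tail_sub_sum_head v
    rw [if_neg (hv p hp).1, if_neg (hv p hp).2] at this
    rw [sub_self, sub_eq_zero] at this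
    rw [this]

end MultiDigraph

/-! ### Points of the flow polytope as combinations of layerings -/

namespace Augmentation

open MultiDigraph Classical

variable {V E VX VY EX EY : Type*} [Fintype EX] [Fintype EY]
  {G : MultiDigraph V E} {a : V → ℤ} {A : Augmentation G a VX VY EX EY} [Fintype A.graph.Route]

/-- The flow on inflow and outflow edges is fixed by `t`, so nothing is lost by restricting a
balanced route flow to `E`. -/
theorem IsBalanced.routeFlow_eq {c : A.graph.Route → ℝ} {t : ℝ} (hc : IsBalanced c t) :
    routeFlow c = A.augFlow (fun e => routeFlow c (.inl e)) t := by
  ext e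
  rcases e with e | x | y
  · rfl
  · simp only [routeFlow, augFlow, ← hc.sum_start (A.xTail x), inflow_mem_edges_iff]
  · simp only [routeFlow, augFlow, ← hc.sum_finish (A.yHead y), outflow_mem_edges_iff]

theorem IsBalanced.conserved [Fintype E] (hG : G.IsDAG) {c : A.graph.Route → ℝ} {t : ℝ}
    (hc : IsBalanced c t) (v : V) :
    ∑ e with A.graph.head e = .inl v, routeFlow c e =
      ∑ e with A.graph.tail e = .inl v, routeFlow c e := by
  have := routeFlow_conserved (isDAG_graph (A := A) hG) (c := c) (v := .inl v) fun p hp => by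
    obtain ⟨⟨s, hs⟩, y, hy⟩ := hc.isThrough p hp
    simp [hs, hy]
  convert this

theorem IsBalanced.netflow_eq [Fintype E] (hG : G.IsDAG) {c : A.graph.Route → ℝ} {t : ℝ}
    (hc : IsBalanced c t) (v : V) :
    (∑ e with G.tail e = v, routeFlow c (.inl e)) - (∑ e with G.head e = v, routeFlow c (.inl e)) =
      t * a v := by
  have h₁ := hc.conserved hG v
  have h₂ := A.netflow_augFlow (fun e => routeFlow c (.inl e)) t v
  rw [← hc.routeFlow_eq] at h₂
  linarith

theorem routeFlow_layerSum (S : Finset (Finset A.graph.Route)) (w : Finset A.graph.Route → ℝ)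
    (e : E) : routeFlow (layerSum S w) (.inl e) = (∑ L ∈ S, w L • A.layeringIndicator L) e := by
  simp only [routeFlow, layerSum, Finset.sum_apply, Pi.smul_apply, smul_eq_mul]
  rw [Finset.sum_comm]
  refine Finset.sum_congr rfl fun L _ => ?_
  rw [← Finset.mul_sum, layeringIndicator_apply]
  congr 1
  rw [← Finset.sum_filter, ← Finset.sum_filter, Finset.filter_filter]
  congr 1
  ext
  simp [and_comm]

namespace Framing

variable {F : A.Framing}

/-- The weights of a route-clique are determined by their flow. -/
theorem eq_followWeight_of_isBalanced [Finite V] [Finite VX] [Finite VY] [Fintype E] (hG : G.IsDAG)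
    {c : A.graph.Route → ℝ} {t : ℝ} (hc : IsBalanced c t) (hcl : F.IsRouteClique {p | c p ≠ 0})
    {p : A.graph.Route} (hp : p.edges ≠ []) :
    c p = followWeight (offset F.IncLT (routeFlow c)) (offset F.OutLT (routeFlow c)) (routeFlow c)
      p.edges :=
  eq_followWeight (isDAG_graph hG) F.isFiberOrder_outLT F.isFiberOrder_incLT
    (isConserved_of_inl (hc.conserved hG)) hc.nonneg
    (fun _ _ hp hq => hcl.not_crosses hp hq) (fun _ => rfl) hp

/-- A point of the flow polytope lies in the relative interior of at most one simplex. -/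
theorem IsLayeringSimplex.eq_of_sum_eq [Finite V] [Finite VX] [Finite VY] [Fintype E]
    (hG : G.IsDAG) {S T : Finset (Finset A.graph.Route)}
    (hS : F.IsLayeringSimplex S) (hT : F.IsLayeringSimplex T) {v w : Finset A.graph.Route → ℝ}
    (hv : ∀ L ∈ S, 0 < v L) (hw : ∀ L ∈ T, 0 < w L) (hvw : ∑ L ∈ S, v L = ∑ L ∈ T, w L)
    (h : ∑ L ∈ S, v L • A.layeringIndicator L = ∑ L ∈ T, w L • A.layeringIndicator L) :
    S = T ∧ ∀ L ∈ S, v L = w L := by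
  have hbS := isBalanced_layerSum hS.isLayering fun L hL => (hv L hL).le
  have hbT := isBalanced_layerSum hT.isLayering fun L hL => (hw L hL).le
  have hflow : routeFlow (layerSum S v) = routeFlow (layerSum T w) := by
    rw [hbS.routeFlow_eq, hbT.routeFlow_eq, hvw]
    congr 1
    ext e
    rw [routeFlow_layerSum, routeFlow_layerSum, h]
  refine hS.unique hT hv hw fun p => ?_
  by_cases hp : p.edges = []
  · have h₁ : layerSum S v p = 0 := by
      by_contra h₁
      exact (hbS.isThrough p h₁).edges_ne_nil hp
    have h₂ : layerSum T w p = 0 := by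
      by_contra h₁
      exact (hbT.isThrough p h₁).edges_ne_nil hp
    rw [h₁, h₂]
  · rw [eq_followWeight_of_isBalanced hG hbS (hS.isRouteClique_layerSum hv) hp,
      eq_followWeight_of_isBalanced hG hbT (hT.isRouteClique_layerSum hw) hp, hflow]

/-- The coefficient of the least member is itself a route weight; subtracting that member leaves
integer route weights for the rest. -/
theorem IsLayeringSimplex.integer_of_layerSum [Finite VX] {S : Finset (Finset A.graph.Route)}
    (hS : F.IsLayeringSimplex S) {w : Finset A.graph.Route → ℝ}
    (h : ∀ p, ∃ n : ℤ, layerSum S w p = n) : ∀ L ∈ S, ∃ n : ℤ, w L = n := by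
  induction hn : S.card generalizing S with
  | zero =>
    rw [Finset.card_eq_zero] at hn
    simp [hn]
  | succ n ih =>
    obtain ⟨L, hL, hmin⟩ := hS.exists_least (Finset.card_pos.1 (by omega))
    obtain ⟨p, hp, hnew⟩ := hS.exists_new L hL
    obtain ⟨k, hk⟩ := h p
    rw [layerSum_eq_of_least hL hp hmin hnew] at hk
    have := ih (hS.mono (S.erase_subset L)) (fun p => by
      obtain ⟨m, hm⟩ := h p
      rw [layerSum_erase hL, hk, hm]
      exact ⟨m - k * if p ∈ L then 1 else 0, by push_cast; rfl⟩)
      (by rw [Finset.card_erase_of_mem hL]; omega)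
    intro M hM
    by_cases hML : M = L
    · exact ⟨k, hML ▸ hk⟩
    · exact this M (Finset.mem_erase.2 ⟨hML, hM⟩)

/-- An integer combination of the vertices of a simplex has integer coefficients. -/
theorem IsLayeringSimplex.integer_of_sum [Finite V] [Finite VX] [Finite VY] [Fintype E]
    (hG : G.IsDAG) {S : Finset (Finset A.graph.Route)} (hS : F.IsLayeringSimplex S)
    {w : Finset A.graph.Route → ℝ} (hw : ∃ n : ℤ, ∑ L ∈ S, w L = n)
    (h : IsIntegerPoint (∑ L ∈ S, w L • A.layeringIndicator L)) : ∀ L ∈ S, ∃ n : ℤ, w L = n := by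
  -- The dynamics requires nonnegative weights; adding a large natural number to all coefficients
  -- does not affect their integrality.
  obtain ⟨N, hN⟩ : ∃ N : ℕ, ∀ L ∈ S, 0 < w L + N := by
    obtain ⟨N, hN⟩ := exists_nat_gt (∑ L ∈ S, |w L|)
    refine ⟨N, fun L hL => ?_⟩
    have h₁ := Finset.single_le_sum (f := fun L => |w L|) (fun L _ => abs_nonneg (w L)) hL
    have h₂ := neg_abs_le (w L)
    linarith
  have hb := isBalanced_layerSum hS.isLayering fun L hL => (hN L hL).le
  -- On `E` the shift adds integer multiples of integer vectors; on inflow and outflow edges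
  -- integrality comes from that of the total weight.
  have hF : ∀ e, ∃ n : ℤ, routeFlow (layerSum S fun L => w L + N) e = n := by
    obtain ⟨k, hk⟩ := hw
    have hsum : ∑ L ∈ S, (w L + N) = ((k + S.card * N : ℤ) : ℝ) := by
      rw [Finset.sum_add_distrib, hk]
      simp
    intro e
    rcases e with e | x | y
    · obtain ⟨m, hm⟩ := h e
      choose j hj using fun L : Finset A.graph.Route => isIntegerPoint_layeringIndicator L e
      refine ⟨m + ∑ L ∈ S, N * j L, ?_⟩
      rw [routeFlow_layerSum]
      simp only [add_smul, Finset.sum_add_distrib]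
      rw [Pi.add_apply, hm]
      simp [Finset.sum_apply, hj]
    · rw [hb.routeFlow_eq]
      exact ⟨_, hsum⟩
    · rw [hb.routeFlow_eq]
      refine ⟨(k + S.card * N) * |A.aY (A.yHead y)|, ?_⟩
      rw [augFlow, hsum]
      push_cast
      rfl
  have hoff : ∀ (r : E ⊕ EX ⊕ EY → E ⊕ EX ⊕ EY → Prop) (e : E ⊕ EX ⊕ EY), ∃ n : ℤ,
      offset r (routeFlow (layerSum S fun L => w L + N)) e = n := by
    intro r e
    choose j hj using hF
    exact ⟨∑ g with r g e, j g, by simp [offset, hj]⟩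
  have := hS.integer_of_layerSum (w := fun L => w L + N) fun p => by
    by_cases hp : p.edges = []
    · refine ⟨0, ?_⟩
      by_contra h₁
      exact (hb.isThrough p (by simpa using h₁)).edges_ne_nil hp
    · rw [eq_followWeight_of_isBalanced hG hb (hS.isRouteClique_layerSum hN) hp]
      exact followWeight_integer hp (hoff _) (hoff _) hF
  intro L hL
  obtain ⟨n, hn⟩ := this L hL
  exact ⟨n - N, by push_cast; linarith⟩

/-- Every point of the flow polytope lies in the relative interior of a simplex. -/
theorem exists_of_mem_flowPolytope [Finite V] [Fintype VX] [Fintype VY] [Nonempty VX] [Fintype E]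
    (hG : G.IsDAG) {f : E → ℝ} (hf : f ∈ G.flowPolytope a) :
    ∃ (S : Finset (Finset A.graph.Route)) (w : Finset A.graph.Route → ℝ),
      F.IsLayeringSimplex S ∧ (∀ L ∈ S, 0 < w L) ∧ ∑ L ∈ S, w L = 1 ∧
      ∑ L ∈ S, w L • A.layeringIndicator L = f := by
  set H := A.augFlow f 1 with hH
  have hH0 : ∀ e, 0 ≤ H e := by
    rintro (e | x | y)
    · exact hf.1 e
    · simp [H, augFlow]
    · simp [H, augFlow]
  have hcons := A.augFlow_conserved (f := f) (t := 1) (fun v => by rw [one_mul]; exact hf.2 v)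
  rw [← hH] at hcons
  -- Conservation holds at all of `V`, so a source or sink in `V` has no flow at its edges. Hence no
  -- weighted route starts or ends in `V`.
  have hzero : ∀ e v, A.graph.tail e = .inl v ∧ A.graph.IsSource (.inl v) ∨
      A.graph.head e = .inl v ∧ A.graph.IsSink (.inl v) → H e = 0 := by
    rintro e v (⟨he, hv⟩ | ⟨he, hv⟩)
    · have h₁ := hcons v
      rw [Finset.sum_eq_zero (fun g hg => (hv g (by simpa using hg)).elim)] at h₁
      exact (Finset.sum_eq_zero_iff_of_nonneg fun g _ => hH0 g).1 h₁.symm e (by simp [he])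
    · have h₁ := hcons v
      rw [Finset.sum_eq_zero (s := Finset.univ.filter fun e => A.graph.tail e = .inl v)
        (fun g hg => (hv g (by simpa using hg)).elim)] at h₁
      exact (Finset.sum_eq_zero_iff_of_nonneg fun g _ => hH0 g).1 h₁ e (by simp [he])
  let c : A.graph.Route → ℝ := fun p => followWeight (offset F.IncLT H) (offset F.OutLT H) H p.edges
  have hsum : routeFlow c = H := by
    ext e
    exact sum_followWeight (isDAG_graph hG) F.isFiberOrder_outLT F.isFiberOrder_incLT hH0
      (isConserved_of_inl hcons) e
  have hfol : ∀ p, c p ≠ 0 → p.edges ≠ [] ∧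
      ∃ y, Follows (offset F.IncLT H) (offset F.OutLT H) H y p.edges := by
    intro p hp
    refine ⟨fun h => hp ?_, exists_follows_of_followWeight_ne_zero hp⟩
    -- Every real number follows the empty list, and the infinite volume of the line has real value
    -- `0`.
    simp [c, h, followWeight, Follows, MeasureTheory.measureReal_def]
  have hpos : ∀ p, c p ≠ 0 → ∀ e ∈ p.edges, H e ≠ 0 := by
    intro p hp e he h0
    obtain ⟨-, y, hy⟩ := hfol p hp
    obtain ⟨l₁, l₂, hl⟩ := List.append_of_mem he
    rw [hl, follows_append] at hy
    have := hy.2.1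
    rw [h0] at this
    linarith
  have hbal : IsBalanced c 1 := by
    refine ⟨fun p => followWeight_nonneg _, fun p hp => ⟨?_, ?_⟩, fun s => ?_, fun y => ?_⟩
    · obtain ⟨e, l, hl⟩ := List.exists_cons_of_ne_nil (hfol p hp).1
      have hpath := p.isPath
      rw [hl] at hpath
      rcases hs : p.start with v | s | y
      · refine (hpos p hp e (by simp [hl]) (hzero e v (Or.inl ⟨hpath.1.trans hs, ?_⟩))).elim
        exact hs ▸ p.isSource_start
      · exact ⟨s, rfl⟩
      · exact (not_isSource_outflow y (hs ▸ p.isSource_start)).elim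
    · obtain ⟨l, e, hl⟩ := (List.eq_nil_or_concat p.edges).resolve_left (hfol p hp).1
      have hpath := p.isPath
      rw [hl, List.concat_eq_append, isPath_append] at hpath
      obtain ⟨w, -, hw⟩ := hpath
      rcases hs : p.finish with v | s | y
      · refine (hpos p hp e (by simp [hl]) (hzero e v (Or.inr ⟨hw.2.trans hs, ?_⟩))).elim
        exact hs ▸ p.isSink_finish
      · exact (not_isSink_inflow s (hs ▸ p.isSink_finish)).elim
      · exact ⟨y, rfl⟩
    · obtain ⟨x, rfl, -⟩ := A.existsUnique_x s
      have := congrFun hsum (.inr (.inl x))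
      simp only [routeFlow, inflow_mem_edges_iff] at this
      rw [this]
      rfl
    · obtain ⟨x, rfl, -⟩ := A.existsUnique_y y
      have := congrFun hsum (.inr (.inr x))
      simp only [routeFlow, outflow_mem_edges_iff] at this
      rw [this]
      rfl
  have hcl : F.IsRouteClique {p | c p ≠ 0} := by
    have key : ∀ p q, c p ≠ 0 → c q ≠ 0 → ¬ F.Cross p q := by
      intro p q hp hq
      rw [cross_iff]
      obtain ⟨-, y, hy⟩ := hfol p hp
      obtain ⟨-, z, hz⟩ := hfol q hq
      exact not_crosses_of_follows F.isFiberOrder_outLT F.isFiberOrder_incLT hH0 hy hz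
    exact fun p hp q hq => ⟨key p q hp hq, key q p hq hp⟩
  obtain ⟨S, w, hS, hw, hcS⟩ := exists_layerSum_eq zero_le_one hbal hcl
  have hcS' : c = layerSum S w := funext hcS
  refine ⟨S, w, hS, hw, ?_, ?_⟩
  -- The total coefficient is the weight starting at any one inflow vertex.
  · have h₁ := (isBalanced_layerSum hS.isLayering fun L hL => (hw L hL).le).sum_start
      (Classical.arbitrary VX)
    rw [← hcS', hbal.sum_start] at h₁
    exact h₁.symm
  · ext e
    rw [← routeFlow_layerSum, ← hcS', hsum]
    rfl

end Framing

theorem sum_mem_flowPolytope [Fintype E] (hG : G.IsDAG) {S : Finset (Finset A.graph.Route)}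
    (hS : ∀ L ∈ S, A.IsLayering L) {w : Finset A.graph.Route → ℝ} (hw : ∀ L ∈ S, 0 ≤ w L)
    (hw1 : ∑ L ∈ S, w L = 1) : ∑ L ∈ S, w L • A.layeringIndicator L ∈ G.flowPolytope a := by
  have hb := isBalanced_layerSum hS hw
  refine ⟨fun e => ?_, fun v => ?_⟩
  · rw [← routeFlow_layerSum]
    exact Finset.sum_nonneg fun p _ => hb.nonneg p
  · have := hb.netflow_eq hG v
    simp only [routeFlow_layerSum] at this
    rw [this, hw1, one_mul]

end Augmentation

/-! ### The volume of unimodular simplices -/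

section Volume

open MeasureTheory

/-- The simplex with the vertices `0` and `r • eᵢ`. -/
def cornerSimplex (ι : Type*) [Fintype ι] (r : ℝ) : Set (ι → ℝ) :=
  {x | (∀ i, 0 ≤ x i) ∧ ∑ i, x i ≤ r}

theorem measurableSet_cornerSimplex (ι : Type*) [Fintype ι] (r : ℝ) :
    MeasurableSet (cornerSimplex ι r) := by
  have : IsClosed (cornerSimplex ι r) := by
    simp only [cornerSimplex, Set.ofPred_and, Set.ofPred_forall]
    refine (isClosed_iInter fun i => ?_).inter ?_
    · exact isClosed_le continuous_const (continuous_apply i)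
    · exact isClosed_le (by fun_prop) continuous_const
  exact this.measurableSet

/-- Fixing the first coordinate at `t` leaves a corner simplex of size `r - t`, so the induction
needs all sizes; integrate `(r - t) ^ n / n!` over `[0, r]`. -/
theorem volume_cornerSimplex_fin (n : ℕ) {r : ℝ} (hr : 0 ≤ r) :
    volume (cornerSimplex (Fin n) r) = ENNReal.ofReal (r ^ n / n.factorial) := by
  induction n generalizing r with
  | zero =>
    have : cornerSimplex (Fin 0) r = Set.univ := by
      ext x
      simp [cornerSimplex, hr]
    rw [this]
    simp [volume_pi]
  | succ n ih =>
    have h₁ := (volume_preserving_piFinSuccAbove (fun _ : Fin (n + 1) => ℝ) 0).symm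
      |>.measure_preimage (measurableSet_cornerSimplex (Fin (n + 1)) r).nullMeasurableSet
    rw [← h₁, Measure.volume_eq_prod, Measure.prod_apply
      ((MeasurableEquiv.measurable _) (measurableSet_cornerSimplex _ _))]
    have h₂ : ∀ t : ℝ, volume (Prod.mk t ⁻¹' (⇑(MeasurableEquiv.piFinSuccAbove
        (fun _ : Fin (n + 1) => ℝ) 0).symm ⁻¹' cornerSimplex (Fin (n + 1)) r)) =
        (Set.Icc 0 r).indicator (fun t => ENNReal.ofReal ((r - t) ^ n / n.factorial)) t := by
      intro t
      by_cases ht : t ∈ Set.Icc 0 r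
      · rw [Set.indicator_of_mem ht, ← ih (sub_nonneg.2 ht.2)]
        congr 1
        ext y
        simp [cornerSimplex, MeasurableEquiv.piFinSuccAbove, Fin.forall_fin_succ, Fin.sum_univ_succ,
          ht.1, le_sub_iff_add_le']
      · rw [Set.indicator_of_notMem ht]
        convert measure_empty (μ := (volume : Measure (Fin n → ℝ)))
        ext y
        simp only [Set.mem_preimage, cornerSimplex, Set.mem_ofPred_eq, Set.mem_empty_iff_false,
          iff_false]
        rintro ⟨h, h'⟩
        simp only [MeasurableEquiv.piFinSuccAbove, Fin.forall_fin_succ, Fin.sum_univ_succ] at h h'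
        simp at h h'
        have := Finset.sum_nonneg fun i (_ : i ∈ Finset.univ) => h.2 i
        exact ht ⟨h.1, by linarith⟩
    simp only [h₂]
    rw [lintegral_indicator measurableSet_Icc, ← ofReal_integral_eq_lintegral_ofReal]
    · congr 1
      rw [integral_Icc_eq_integral_Ioc, ← intervalIntegral.integral_of_le hr]
      rw [intervalIntegral.integral_div, intervalIntegral.integral_comp_sub_left (fun x => x ^ n)]
      simp only [sub_self, sub_zero, integral_pow]
      rw [Nat.factorial_succ]
      push_cast
      field_simp
      simp
    · exact (Continuous.integrableOn_Icc (by fun_prop))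
    · refine (ae_restrict_iff' measurableSet_Icc).2 (Filter.Eventually.of_forall fun t ht => ?_)
      have := sub_nonneg.2 ht.2
      positivity

theorem volume_real_cornerSimplex (ι : Type*) [Fintype ι] :
    volume.real (cornerSimplex ι 1) = ((Fintype.card ι).factorial : ℝ)⁻¹ := by
  let e := Fintype.equivFin ι
  have h := (volume_measurePreserving_piCongrLeft (fun _ : Fin (Fintype.card ι) => ℝ) e)
    |>.measure_preimage (measurableSet_cornerSimplex (Fin (Fintype.card ι)) 1).nullMeasurableSet
  have h' : ⇑(MeasurableEquiv.piCongrLeft (fun _ : Fin (Fintype.card ι) => ℝ) e) ⁻¹'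
      cornerSimplex (Fin (Fintype.card ι)) 1 = cornerSimplex ι 1 := by
    ext x
    have hx : ∀ i, (MeasurableEquiv.piCongrLeft (fun _ : Fin (Fintype.card ι) => ℝ) e) x (e i) = x i :=
      fun i => by
        rw [MeasurableEquiv.coe_piCongrLeft]
        exact Equiv.piCongrLeft_apply_apply (fun _ : Fin (Fintype.card ι) => ℝ) e x i
    simp only [cornerSimplex, Set.mem_preimage, Set.mem_ofPred_eq]
    rw [← e.sum_comp]
    simp only [hx]
    refine and_congr_left fun _ => ?_
    rw [← e.forall_congr_right]
    simp only [hx]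
  rw [measureReal_def, ← h', h, volume_cornerSimplex_fin _ zero_le_one]
  rw [ENNReal.toReal_ofReal (by positivity)]
  simp

/-- Coefficients are attached to indices rather than points, so `p` need not be injective. -/
theorem mem_convexHull_image_iff {κ M : Type*} [AddCommGroup M] [Module ℝ M] {S : Finset κ}
    {p : κ → M} {x : M} : x ∈ convexHull ℝ (p '' S) ↔
      ∃ w : κ → ℝ, (∀ i ∈ S, 0 ≤ w i) ∧ ∑ i ∈ S, w i = 1 ∧ ∑ i ∈ S, w i • p i = x := by
  classical
  constructor
  · intro hx
    have hconv : Convex ℝ {x | ∃ w : κ → ℝ, (∀ i ∈ S, 0 ≤ w i) ∧ ∑ i ∈ S, w i = 1 ∧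
        ∑ i ∈ S, w i • p i = x} := by
      rintro _ ⟨v, hv, hv1, rfl⟩ _ ⟨w, hw, hw1, rfl⟩ s t hs ht hst
      refine ⟨fun i => s * v i + t * w i, fun i hi => ?_, ?_, ?_⟩
      · have := hv i hi
        have := hw i hi
        positivity
      · rw [Finset.sum_add_distrib, ← Finset.mul_sum, ← Finset.mul_sum, hv1, hw1]
        linarith
      · simp only [add_smul, mul_smul, Finset.sum_add_distrib, Finset.smul_sum]
    refine convexHull_min ?_ hconv hx
    rintro _ ⟨i, hi, rfl⟩
    exact ⟨Pi.single i 1, fun j _ => by rw [Pi.single_apply]; split_ifs <;> simp,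
      by simpa [Pi.single_apply] using hi, by simpa [Pi.single_apply] using fun h => (h hi).elim⟩
  · rintro ⟨w, hw, hw1, rfl⟩
    exact (convex_convexHull ℝ _).sum_mem hw hw1 fun i hi => subset_convexHull _ _ ⟨i, hi, rfl⟩

set_option synthInstance.maxHeartbeats 200000 in
/-- The lattice volume of a translate of the simplex spanned by a lattice basis. -/
theorem latticeVolume_eq_of_basis {E ι : Type*} [Fintype E] [Fintype ι] (W : Submodule ℝ (E → ℝ))
    (b : Module.Basis ι ℝ W) (hb : integerPoints W = Submodule.span ℤ (Set.range b)) (w₀ : W) :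
    latticeVolume W {w | b.equivFun (w + w₀) ∈ cornerSimplex ι 1} =
      ((Fintype.card ι).factorial : ℝ)⁻¹ := by
  set μ : Measure W := Measure.addHaar with hμ
  let e : W ≃L[ℝ] (ι → ℝ) := b.equivFun.toContinuousLinearEquiv
  -- In the coordinates of `b`, Haar measure is `c` times Lebesgue measure. A fundamental domain
  -- becomes the unit cube, so the covolume is `c`, and it cancels in the quotient.
  have hsmul := Measure.isAddLeftInvariant_eq_smul (μ.map e) (volume : Measure (ι → ℝ))
  set c := Measure.addHaarScalarFactor (μ.map e) (volume : Measure (ι → ℝ)) with hc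
  have hmap : ∀ s : Set (ι → ℝ), MeasurableSet s → μ.real (e ⁻¹' s) = c * volume.real s := by
    intro s hs
    have h := congrArg (fun ν : Measure (ι → ℝ) => ν s) hsmul
    rw [Measure.map_apply e.continuous.measurable hs] at h
    rw [measureReal_def, h, measureReal_def]
    simp
  have hcov : ZLattice.covolume (integerPoints W) μ = c := by
    rw [hb, ZLattice.covolume_eq_measure_fundamentalDomain _ _ (ZSpan.isAddFundamentalDomain b μ)]
    have : ZSpan.fundamentalDomain b = e ⁻¹' (Set.univ.pi fun _ => Set.Ico 0 1) := by
      ext w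
      simp [ZSpan.mem_fundamentalDomain, e, Set.mem_pi]
    rw [this, hmap _ (MeasurableSet.univ_pi fun _ => measurableSet_Ico), measureReal_def,
      volume_pi_pi]
    simp
  have hpos : (c : ℝ) ≠ 0 := by
    rw [← hcov, hb]
    exact ZLattice.covolume_ne_zero _ _
  have hset : {w | b.equivFun (w + w₀) ∈ cornerSimplex ι 1} =
      (fun w => w + w₀) ⁻¹' (e ⁻¹' cornerSimplex ι 1) := rfl
  rw [latticeVolume, hcov, hset, measureReal_def, measure_preimage_add_right, ← measureReal_def,
    hmap _ (measurableSet_cornerSimplex ι 1), volume_real_cornerSimplex]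
  field_simp

/-- A simplex with integer vertices is unimodular if the integer points of its linear span are
integer combinations of its vertices. -/
theorem normalizedVolume_convexHull_eq_one {E κ : Type*} [Fintype E] [Fintype κ] {p : κ → E → ℝ}
    (hp : AffineIndependent ℝ p) (hint : ∀ i, IsIntegerPoint (p i))
    (hcoef : ∀ w : κ → ℝ, ∑ i, w i = 0 → IsIntegerPoint (∑ i, w i • p i) → ∀ i, ∃ n : ℤ, w i = n)
    {x : E → ℝ} (hx : x ∈ convexHull ℝ (Set.range p)) :
    normalizedVolume (convexHull ℝ (Set.range p)) x = 1 := by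
  classical
  obtain ⟨i₀⟩ : Nonempty κ := by
    by_contra h
    rw [not_nonempty_iff] at h
    rw [Set.range_eq_empty, convexHull_empty] at hx
    exact hx
  let v : {i // i ≠ i₀} → E → ℝ := fun i => p i - p i₀
  have hv : LinearIndependent ℝ v := (affineIndependent_iff_linearIndependent_vsub ℝ p i₀).1 hp
  have hW : vectorSpan ℝ (convexHull ℝ (Set.range p)) = Submodule.span ℝ (Set.range v) := by
    rw [← direction_affineSpan, affineSpan_convexHull, direction_affineSpan,
      vectorSpan_range_eq_span_range_vsub_right_ne ℝ p i₀]
    rfl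
  -- Rewriting edge vectors in terms of vertices gives `p i₀` minus the sum of the other
  -- coefficients, so the total is zero as `hcoef` demands.
  have hsum : ∀ u : {i // i ≠ i₀} → ℝ, ∑ i, u i • v i =
      ∑ i, (if h : i ≠ i₀ then u ⟨i, h⟩ else - ∑ j, u j) • p i := by
    intro u
    rw [Fintype.sum_eq_add_sum_subtype_ne _ i₀, dif_neg (by simp)]
    simp only [v, smul_sub, Finset.sum_sub_distrib]
    rw [← Finset.sum_smul, neg_smul, sub_eq_neg_add]
    congr 1
    refine Finset.sum_congr rfl fun i _ => ?_
    rw [dif_pos i.2]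
  have hsum0 : ∀ u : {i // i ≠ i₀} → ℝ,
      ∑ i, (if h : i ≠ i₀ then u ⟨i, h⟩ else - ∑ j, u j) = 0 := by
    intro u
    rw [Fintype.sum_eq_add_sum_subtype_ne _ i₀, dif_neg (by simp), neg_add_eq_zero]
    refine Finset.sum_congr rfl fun i _ => ?_
    rw [dif_pos i.2]
  rw [normalizedVolume, hW]
  let b : Module.Basis {i // i ≠ i₀} ℝ (Submodule.span ℝ (Set.range v)) := Module.Basis.span hv
  have hbv : ∀ i, ((b i : Submodule.span ℝ (Set.range v)) : E → ℝ) = v i := fun i =>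
    congrArg Subtype.val (Module.Basis.span_apply hv i)
  have hrepr : ∀ w : Submodule.span ℝ (Set.range v), (w : E → ℝ) = ∑ i, b.equivFun w i • v i := by
    intro w
    conv_lhs => rw [← b.sum_equivFun w]
    rw [Submodule.coe_sum]
    simp only [Submodule.coe_smul, hbv]
  have hb : integerPoints (Submodule.span ℝ (Set.range v)) = Submodule.span ℤ (Set.range b) := by
    apply le_antisymm
    · intro w hw
      rw [b.mem_span_iff_repr_mem ℤ]
      intro i
      have hw' : IsIntegerPoint (w : E → ℝ) := hw
      rw [hrepr, hsum] at hw'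
      obtain ⟨n, hn⟩ := hcoef _ (hsum0 _) hw' i
      rw [dif_pos i.2] at hn
      exact ⟨n, by simpa using hn.symm⟩
    · rw [Submodule.span_le]
      rintro _ ⟨i, rfl⟩
      intro e
      obtain ⟨m, hm⟩ := hint i e
      obtain ⟨n, hn⟩ := hint i₀ e
      exact ⟨m - n, by simp [hbv, v, hm, hn]⟩
  have hmem : ∀ w : Submodule.span ℝ (Set.range v),
      p i₀ + (w : E → ℝ) ∈ convexHull ℝ (Set.range p) ↔ b.equivFun w ∈ cornerSimplex _ 1 := by
    intro w
    have hco : ∀ u : κ → ℝ, ∑ i, u i = 1 →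
        ∑ i, u i • p i = p i₀ + ∑ i : {i // i ≠ i₀}, u i • v i := by
      intro u hu
      rw [Fintype.sum_eq_add_sum_subtype_ne _ i₀] at hu ⊢
      simp only [v, smul_sub, Finset.sum_sub_distrib]
      rw [← Finset.sum_smul, eq_sub_of_add_eq hu, sub_smul, one_smul]
      abel
    rw [← Set.image_univ, ← Finset.coe_univ, mem_convexHull_image_iff]
    constructor
    · rintro ⟨u, hu0, hu1, hu⟩
      rw [hco u hu1, add_right_inj] at hu
      have hw : b.equivFun w = fun i => u i.1 := by
        rw [← LinearEquiv.eq_symm_apply, Module.Basis.equivFun_symm_apply]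
        ext1
        rw [← hu, Submodule.coe_sum]
        simp only [Submodule.coe_smul, hbv]
      rw [hw]
      refine ⟨fun i => hu0 i (Finset.mem_univ _), ?_⟩
      rw [Fintype.sum_eq_add_sum_subtype_ne _ i₀] at hu1
      linarith [hu0 i₀ (Finset.mem_univ _)]
    · rintro ⟨h0, h1⟩
      have hu1 : ∑ i, (if h : i ≠ i₀ then b.equivFun w ⟨i, h⟩ else 1 - ∑ j, b.equivFun w j) =
          1 := by
        rw [Fintype.sum_eq_add_sum_subtype_ne _ i₀, dif_neg (by simp), sub_add_eq_add_sub,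
          add_sub_assoc, add_eq_left, sub_eq_zero]
        exact Finset.sum_congr rfl fun i _ => by rw [dif_pos i.2]
      refine ⟨_, fun i _ => ?_, hu1, ?_⟩
      · split_ifs
        · exact h0 _
        · linarith
      · rw [hco _ hu1, hrepr w]
        congr 1
        exact Finset.sum_congr rfl fun i _ => by rw [dif_pos i.2]
  -- Since `x` is any point of the simplex, the set to be measured is a translate, by `x - p i₀`, of
  -- the one based at `p i₀`.
  have hxW : x - p i₀ ∈ Submodule.span ℝ (Set.range v) := by
    rw [← hW]
    exact vsub_mem_vectorSpan ℝ hx (subset_convexHull _ _ ⟨i₀, rfl⟩)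
  have hset : {w : Submodule.span ℝ (Set.range v) | x + (w : E → ℝ) ∈ convexHull ℝ (Set.range p)} =
      {w | b.equivFun (w + ⟨x - p i₀, hxW⟩) ∈ cornerSimplex _ 1} := by
    ext w
    rw [Set.mem_ofPred_eq, Set.mem_ofPred_eq, ← hmem]
    simp only [Submodule.coe_add]
    rw [show p i₀ + ((w : E → ℝ) + (x - p i₀)) = x + w by abel]
  rw [hset, latticeVolume_eq_of_basis _ b hb, finrank_span_eq_card hv]
  exact mul_inv_cancel₀ (by positivity)

end Volume

/-! ### Triangulations from unique positive combinations -/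

section Triangulation

/-- The vertices of a simplex are its extreme points. -/
theorem IsVertexSet.extremePoints_eq {E : Type*} [Finite E] {s : Finset (E → ℝ)}
    {Δ : Set (E → ℝ)} (h : IsVertexSet s Δ) : Δ.extremePoints ℝ = s := by
  classical
  have := Fintype.ofFinite E
  obtain ⟨hs, rfl⟩ := h
  refine Set.Subset.antisymm extremePoints_convexHull_subset fun x hx => ?_
  by_contra hne
  have hsub : (convexHull ℝ (s : Set (E → ℝ))).extremePoints ℝ ⊆ (s.erase x : Finset _) := by
    intro y hy
    rw [Finset.mem_coe, Finset.mem_erase]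
    exact ⟨fun hyx => hne (hyx ▸ hy), extremePoints_convexHull_subset hy⟩
  -- If the vertex `x` were not extreme, then by Krein–Milman the remaining vertices would span the
  -- whole simplex, against affine independence.
  have hmem : x ∈ convexHull ℝ ((s.erase x : Finset _) : Set (E → ℝ)) := by
    have h₁ := closure_convexHull_extremePoints (s := convexHull ℝ (s : Set (E → ℝ)))
      (s.finite_toSet.isCompact_convexHull ℝ) (convex_convexHull ℝ _)
    have h₂ : x ∈ convexHull ℝ (s : Set (E → ℝ)) := subset_convexHull _ _ hx
    rw [← h₁] at h₂
    exact closure_minimal (convexHull_mono hsub)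
      ((s.erase x).finite_toSet.isClosed_convexHull ℝ) h₂
  have h₃ := hs.convexHull_inter (t₁ := {x}) (t₂ := s.erase x) (by simpa using hx)
    (Finset.erase_subset _ _)
  have h₄ : x ∈ convexHull ℝ ((({x} : Finset (E → ℝ)) ∩ s.erase x : Finset _) : Set (E → ℝ)) := by
    rw [Finset.coe_inter, h₃]
    exact ⟨subset_convexHull _ _ (by simp), hmem⟩
  simp at h₄

variable {κ E : Type*} {J : κ → E → ℝ} {𝒮 : Set (Finset κ)}

/-- Positive combinations over the members of `𝒮` determine their coefficients. -/
def UniqueCombinations (J : κ → E → ℝ) (𝒮 : Set (Finset κ)) : Prop :=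
  ∀ S ∈ 𝒮, ∀ T ∈ 𝒮, ∀ v w : κ → ℝ, (∀ i ∈ S, 0 < v i) → (∀ i ∈ T, 0 < w i) →
    ∑ i ∈ S, v i = ∑ i ∈ T, w i → ∑ i ∈ S, v i • J i = ∑ i ∈ T, w i • J i →
    S = T ∧ ∀ i ∈ S, v i = w i

namespace UniqueCombinations

/-- Adding a large constant to all coefficients turns the relation into an equality of two positive
combinations of equal total weight. -/
theorem eq_zero (h : UniqueCombinations J 𝒮) {S : Finset κ} (hS : S ∈ 𝒮) {w : κ → ℝ}
    (hw : ∑ i ∈ S, w i = 0) (hwJ : ∑ i ∈ S, w i • J i = 0) : ∀ i ∈ S, w i = 0 := by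
  obtain ⟨N, hN⟩ : ∃ N : ℝ, ∀ i ∈ S, 0 < N ∧ 0 < w i + N := by
    refine ⟨∑ i ∈ S, |w i| + 1, fun i hi => ?_⟩
    have h₁ := Finset.single_le_sum (f := fun i => |w i|) (fun i _ => abs_nonneg (w i)) hi
    have h₂ := neg_abs_le (w i)
    have h₃ := abs_nonneg (w i)
    constructor <;> linarith
  intro i hi
  have := (h S hS S hS (fun i => w i + N) (fun _ => N) (fun i hi => (hN i hi).2)
    (fun i hi => (hN i hi).1) (by rw [Finset.sum_add_distrib, hw, zero_add])
    (by simp only [add_smul, Finset.sum_add_distrib, hwJ, zero_add])).2 i hi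
  linarith

theorem affineIndependent (h : UniqueCombinations J 𝒮) {S : Finset κ} (hS : S ∈ 𝒮) :
    AffineIndependent ℝ fun i : S => J i := by
  classical
  rw [affineIndependent_iff]
  intro t w hw hwJ i hi
  let w' : κ → ℝ := fun j => if hj : j ∈ S then (if (⟨j, hj⟩ : S) ∈ t then w ⟨j, hj⟩ else 0) else 0
  have hw' : ∀ j : S, w' j = if j ∈ t then w j else 0 := fun j => by simp [w']
  have h₁ : ∑ j ∈ S, w' j = 0 := by
    rw [← Finset.sum_coe_sort]
    simp only [hw']
    rwa [← Finset.sum_filter, Finset.filter_univ_mem]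
  have h₂ : ∑ j ∈ S, w' j • J j = 0 := by
    rw [← Finset.sum_coe_sort S fun j => w' j • J j]
    simp only [hw', ite_smul, zero_smul]
    rwa [← Finset.sum_filter, Finset.filter_univ_mem]
  have := h.eq_zero hS h₁ h₂ i i.2
  rwa [hw', if_pos hi] at this

theorem isVertexSet [DecidableEq (E → ℝ)] (h : UniqueCombinations J 𝒮) {S : Finset κ}
    (hS : S ∈ 𝒮) : IsVertexSet (S.image J) (convexHull ℝ (J '' S)) := by
  refine ⟨?_, by rw [Finset.coe_image]⟩
  have h₁ := (h.affineIndependent hS).range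
  have h₂ : Set.range (fun i : S => J i) = ((S.image J : Finset (E → ℝ)) : Set (E → ℝ)) := by
    ext
    simp
  rw [h₂] at h₁
  exact h₁

/-- Restrict both expressions of a common point to the indices with positive coefficients. These
subsets again belong to `𝒮`, so uniqueness makes them equal, and they lie in `S ∩ T`. -/
theorem convexHull_inter [DecidableEq κ] (h : UniqueCombinations J 𝒮)
    (hdown : ∀ S ∈ 𝒮, ∀ T ⊆ S, T ∈ 𝒮) {S T : Finset κ} (hS : S ∈ 𝒮) (hT : T ∈ 𝒮) :
    convexHull ℝ (J '' S) ∩ convexHull ℝ (J '' T) = convexHull ℝ (J '' ((S ∩ T : Finset κ))) := by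
  refine Set.Subset.antisymm ?_ (Set.subset_inter
    (convexHull_mono (Set.image_mono (by simp)))
    (convexHull_mono (Set.image_mono (by simp))))
  rintro x ⟨hx, hx'⟩
  rw [mem_convexHull_image_iff] at hx hx'
  obtain ⟨v, hv, hv1, hvx⟩ := hx
  obtain ⟨w, hw, hw1, hwx⟩ := hx'
  have key : ∀ (R : Finset κ) (u : κ → ℝ), (∀ i ∈ R, 0 ≤ u i) →
      (∀ i ∈ R.filter (fun i => u i ≠ 0), 0 < u i) ∧
      ∑ i ∈ R with u i ≠ 0, u i = ∑ i ∈ R, u i ∧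
      ∑ i ∈ R with u i ≠ 0, u i • J i = ∑ i ∈ R, u i • J i := by
    intro R u hu
    refine ⟨fun i hi => ?_, Finset.sum_filter_ne_zero _, ?_⟩
    · rw [Finset.mem_filter] at hi
      exact (hu i hi.1).lt_of_ne' hi.2
    · refine Finset.sum_filter_of_ne fun i _ hi h0 => hi ?_
      rw [h0, zero_smul]
  obtain ⟨a₁, a₂, a₃⟩ := key S v hv
  obtain ⟨b₁, b₂, b₃⟩ := key T w hw
  have heq := (h _ (hdown S hS _ (Finset.filter_subset _ _)) _
    (hdown T hT _ (Finset.filter_subset _ _)) v w a₁ b₁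
    (by rw [a₂, b₂, hv1, hw1]) (by rw [a₃, b₃, hvx, hwx])).1
  have hsub : S.filter (fun i => v i ≠ 0) ⊆ S ∩ T :=
    Finset.subset_inter (Finset.filter_subset _ _) (heq ▸ Finset.filter_subset _ _)
  refine convexHull_mono (Set.image_mono (Finset.coe_subset.2 hsub)) ?_
  rw [mem_convexHull_image_iff]
  exact ⟨v, fun i hi => (a₁ i hi).le, a₂.trans hv1, a₃.trans hvx⟩

theorem isSimplexFace [Finite E] (h : UniqueCombinations J 𝒮)
    {S T : Finset κ} (hS : S ∈ 𝒮) (hTS : T ⊆ S) :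
    IsSimplexFace (convexHull ℝ (J '' T)) (convexHull ℝ (J '' S)) := by
  classical
  exact ⟨S.image J, T.image J, h.isVertexSet hS, Finset.image_subset_image hTS,
    by rw [Finset.coe_image]⟩

/-- A face may be presented with any vertex set of the simplex, but the extreme points leave only
one choice. -/
theorem exists_of_isSimplexFace [Finite E] (h : UniqueCombinations J 𝒮) {S : Finset κ}
    (hS : S ∈ 𝒮) {Δ : Set (E → ℝ)} (hΔ : IsSimplexFace Δ (convexHull ℝ (J '' S))) :
    ∃ T ⊆ S, Δ = convexHull ℝ (J '' T) := by
  classical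
  obtain ⟨s, t, hs, hts, rfl⟩ := hΔ
  have hsS : s = S.image J := by
    rw [← Finset.coe_inj, ← hs.extremePoints_eq, (h.isVertexSet hS).extremePoints_eq]
  subst hsS
  refine ⟨S.filter fun i => J i ∈ t, Finset.filter_subset _ _, ?_⟩
  congr 1
  ext x
  simp only [Finset.mem_coe, Set.mem_image, Finset.mem_filter]
  constructor
  · intro hx
    obtain ⟨i, hi, rfl⟩ := Finset.mem_image.1 (hts hx)
    exact ⟨i, ⟨hi, hx⟩, rfl⟩
  · rintro ⟨i, ⟨-, hi⟩, rfl⟩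
    exact hi

theorem normalizedVolume_eq_one [Fintype E] (h : UniqueCombinations J 𝒮)
    (hint : ∀ i, IsIntegerPoint (J i)) {S : Finset κ} (hS : S ∈ 𝒮)
    (hcoef : ∀ w : κ → ℝ, ∑ i ∈ S, w i = 0 → IsIntegerPoint (∑ i ∈ S, w i • J i) →
      ∀ i ∈ S, ∃ n : ℤ, w i = n) {x : E → ℝ} (hx : x ∈ convexHull ℝ (J '' S)) :
    normalizedVolume (convexHull ℝ (J '' S)) x = 1 := by
  classical
  have hr : J '' S = Set.range fun i : S => J i := by
    ext
    simp
  rw [hr] at hx ⊢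
  refine normalizedVolume_convexHull_eq_one (h.affineIndependent hS) (fun i => hint i)
    (fun w hw hwJ i => ?_) hx
  let w' : κ → ℝ := fun j => if hj : j ∈ S then w ⟨j, hj⟩ else 0
  have hw' : ∀ j : S, w' j = w j := fun j => by simp [w']
  rw [← hw']
  refine hcoef w' ?_ ?_ i i.2
  · rw [← Finset.sum_coe_sort]
    simpa only [hw'] using hw
  · rw [← Finset.sum_coe_sort S fun j => w' j • J j]
    simpa only [hw'] using hwJ

/-- A family of finite sets that is closed under subsets and whose positive combinations are unique,
cover a convex set and have integer coefficients at integer points is a unimodular triangulation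
of that set. -/
theorem isUnimodularTriangulation [Finite κ] [Fintype E] {P : Set (E → ℝ)}
    (h : UniqueCombinations J 𝒮) (hP : Convex ℝ P) (hint : ∀ i, IsIntegerPoint (J i))
    (hdown : ∀ S ∈ 𝒮, ∀ T ⊆ S, T ∈ 𝒮) (hmem : ∀ S ∈ 𝒮, ∀ i ∈ S, J i ∈ P)
    (hcover : ∀ x ∈ P, ∃ S ∈ 𝒮, x ∈ convexHull ℝ (J '' S))
    (hcoef : ∀ S ∈ 𝒮, ∀ w : κ → ℝ, ∑ i ∈ S, w i = 0 → IsIntegerPoint (∑ i ∈ S, w i • J i) →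
      ∀ i ∈ S, ∃ n : ℤ, w i = n) :
    IsUnimodularTriangulation P {Δ | ∃ S, S ∈ 𝒮 ∧ Δ = convexHull ℝ (J '' S)} := by
  classical
  have hsub : ∀ S ∈ 𝒮, convexHull ℝ (J '' S) ⊆ P := fun S hS =>
    convexHull_min (by rintro _ ⟨i, hi, rfl⟩; exact hmem S hS i hi) hP
  refine ⟨⟨?_, ?_, ?_, ?_, ?_, ?_⟩, ?_⟩
  · have hfin : (J '' {i | ∃ S ∈ 𝒮, i ∈ S}).Finite := Set.toFinite _
    refine ⟨hfin.toFinset, fun x hx => ?_, ?_⟩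
    · obtain ⟨i, -, rfl⟩ := hfin.mem_toFinset.1 hx
      exact hint i
    · rw [hfin.coe_toFinset]
      refine Set.Subset.antisymm (fun x hx => ?_) (convexHull_min ?_ hP)
      · obtain ⟨S, hS, hxS⟩ := hcover x hx
        have hsub' : (S : Set κ) ⊆ {i | ∃ S ∈ 𝒮, i ∈ S} := fun i hi => ⟨S, hS, hi⟩
        exact convexHull_mono (Set.image_mono hsub') hxS
      · rintro _ ⟨i, ⟨S, hS, hi⟩, rfl⟩
        exact hmem S hS i hi
  · have : {Δ | ∃ S, S ∈ 𝒮 ∧ Δ = convexHull ℝ (J '' S)} =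
        (fun S : Finset κ => convexHull ℝ (J '' S)) '' 𝒮 := by
      ext
      simp [eq_comm]
    rw [this]
    exact Set.toFinite _
  · rintro _ ⟨S, hS, rfl⟩
    refine ⟨S.image J, fun x hx => ?_, h.isVertexSet hS⟩
    obtain ⟨i, -, rfl⟩ := Finset.mem_image.1 hx
    exact hint i
  · ext x
    constructor
    · intro hx
      obtain ⟨S, hS, hxS⟩ := hcover x hx
      exact ⟨_, ⟨S, hS, rfl⟩, hxS⟩
    · rintro ⟨_, ⟨S, hS, rfl⟩, hxS⟩
      exact hsub S hS hxS
  · rintro _ ⟨S, hS, rfl⟩ Δ hΔ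
    obtain ⟨T, hT, rfl⟩ := h.exists_of_isSimplexFace hS hΔ
    exact ⟨T, hdown S hS T hT, rfl⟩
  · rintro _ ⟨S, hS, rfl⟩ _ ⟨T, hT, rfl⟩
    rw [h.convexHull_inter hdown hS hT]
    exact ⟨h.isSimplexFace hS Finset.inter_subset_left,
      h.isSimplexFace hT Finset.inter_subset_right⟩
  · rintro _ ⟨S, hS, rfl⟩ x hx
    exact h.normalizedVolume_eq_one hint hS (hcoef S hS) hx

end UniqueCombinations

end Triangulation

/-! ### The flow polytope and the main theorem -/

theorem MultiDigraph.convex_flowPolytope {V E : Type*} [Fintype E] (G : MultiDigraph V E)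
    (a : V → ℤ) : Convex ℝ (G.flowPolytope a) := by
  rintro f ⟨hf0, hf⟩ g ⟨hg0, hg⟩ s t hs ht hst
  refine ⟨fun e => ?_, fun i => ?_⟩
  · have := hf0 e
    have := hg0 e
    simp only [Pi.add_apply, Pi.smul_apply, smul_eq_mul]
    positivity
  · simp only [Pi.add_apply, Pi.smul_apply, smul_eq_mul, Finset.sum_add_distrib, ← Finset.mul_sum]
    linear_combination s * hf i + t * hg i + (a i : ℝ) * hst

/-- A nonempty flow polytope with nonzero netflow has an inflow vertex. -/
theorem Augmentation.nonempty_inflow {V E VX VY EX EY : Type*} [Fintype V] [Fintype E] [Fintype EX]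
    [Fintype EY] {G : MultiDigraph V E} {a : V → ℤ} (ha : a ≠ 0)
    (A : Augmentation G a VX VY EX EY) {f : E → ℝ} (hf : f ∈ G.flowPolytope a) : Nonempty VX := by
  classical
  -- Each edge enters the sum of all netflows once with either sign. So a nonzero netflow vector has
  -- a positive entry.
  have hsum : ∑ i, a i = 0 := by
    have h : ∑ i, (a i : ℝ) = 0 := by
      simp only [← hf.2, Finset.sum_sub_distrib]
      rw [sub_eq_zero]
      trans ∑ e, f e
      · exact Finset.sum_fiberwise Finset.univ G.tail f
      · exact (Finset.sum_fiberwise Finset.univ G.head f).symm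
    exact_mod_cast h
  obtain ⟨i, hi⟩ : ∃ i, 0 < a i := by
    by_contra! hcon
    exact ha (funext fun i =>
      (Finset.sum_eq_zero_iff_of_nonpos fun i _ => hcon i).1 hsum i (Finset.mem_univ i))
  have hcard := A.card_xHead i hi
  have hpos : 0 < (Finset.univ.filter fun x => A.xHead x = i).card := by omega
  obtain ⟨x, -⟩ := Finset.card_pos.1 hpos
  exact ⟨A.xTail x⟩

theorem theorem4p6 {V E VX VY EX EY : Type*} [Fintype V] [Fintype E]
    [Fintype VX] [Fintype VY] [Fintype EX] [Fintype EY]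
    (G : MultiDigraph V E) (hG : G.IsDAG) (a : V → ℤ) (ha : a ≠ 0)
    (A : Augmentation G a VX VY EX EY) (F : A.Framing) :
    IsUnimodularTriangulation (G.flowPolytope a) F.triangulation := by
  classical
  have : Finite A.graph.Route := (Augmentation.isDAG_graph hG).finite_route
  have := Fintype.ofFinite A.graph.Route
  have huniq : UniqueCombinations A.layeringIndicator {S | F.IsLayeringSimplex S} :=
    fun S hS T hT v w hv hw hvw h => hS.eq_of_sum_eq hG hT hv hw hvw h
  refine huniq.isUnimodularTriangulation (G.convex_flowPolytope a)
    Augmentation.isIntegerPoint_layeringIndicator (fun S hS T hT => hS.mono hT) ?_ ?_ ?_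
  · intro S hS L hL
    have := Augmentation.sum_mem_flowPolytope hG (S := {L}) (w := fun _ => 1)
      (fun M hM => hS.isLayering M (Finset.mem_singleton.1 hM ▸ hL)) (by simp) (by simp)
    simpa using this
  · intro x hx
    -- The only use of `a ≠ 0`. For `a = 0` the polytope is the single point `0`, but the only
    -- layering is empty and has no new route, so no layering-simplex covers this point.
    have := A.nonempty_inflow ha hx
    obtain ⟨S, w, hS, hw, hw1, hwx⟩ := Augmentation.Framing.exists_of_mem_flowPolytope (F := F) hG hx
    exact ⟨S, hS, mem_convexHull_image_iff.2 ⟨w, fun L hL => (hw L hL).le, hw1, hwx⟩⟩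
  · intro S hS w hw hwJ
    exact hS.integer_of_sum hG ⟨0, by simpa using hw⟩ hwJ
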